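/- Setting. Let $\mathcal A$ be a finite alphabet with $d\ge 2$ letters, let $\pi_t,\pi_b:\mathcal A\to\{1,\dots,d\}$ be bijections which are admissible, i.e. $\pi_t^{-1}(\{1,\dots,k\})\neq\pi_b^{-1}(\{1,\dots,k\})$ for $1\le k\le d-1$, and let $\lambda_\alpha>0$ ($\alpha\in\mathcal A$) be lengths with $\lambda^*=\sum_\alpha\lambda_\alpha=1$. Put $p_\alpha=\sum_{\pi_t(\beta)<\pi_t(\alpha)}\lambda_\beta$, $q_\alpha=\sum_{\pi_b(\beta)<\pi_b(\alpha)}\lambda_\beta$, $I_\alpha=[p_\alpha,p_\alpha+\lambda_\alpha)$, and let $T:[0,1)\to[0,1)$ be the interval exchange map $T(x)=x+q_\alpha-p_\alpha$ for $x\in I_\alpha$. Assume that $T$ has the Keane property: there are no $\alpha,\beta\in\mathcal A$ and $m\ge1$ with $T^m(p_\alpha)=p_\beta$ and $\pi_t(\beta)>1$. Rauzy–Veech induction. Let $\alpha_t,\alpha_b$ be the letters with $\pi_t(\alpha_t)=\pi_b(\alpha_b)=d$. If $\lambda_{\alpha_t}>\lambda_{\alpha_b}$, then $\alpha_t$ is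 the winner and $\alpha_b$ the loser, $\lambda_{\alpha_t}$ is replaced by $\lambda_{\alpha_t}-\lambda_{\alpha_b}$, $\pi_t$ is kept, and in the bottom order $\alpha_b$ is moved to the place directly after $\alpha_t$. If $\lambda_{\alpha_b}>\lambda_{\alpha_t}$, then $\alpha_b$ is the winner and $\alpha_t$ the loser, $\lambda_{\alpha_b}$ is replaced by $\lambda_{\alpha_b}-\lambda_{\alpha_t}$, $\pi_b$ is kept, and in the top order $\alpha_t$ is moved to the place directly after $\alpha_b$. This defines $\mathcal V(T)$; put $T(n)=\mathcal V^n(T)$. To the step from $T(n)$ to $T(n+1)$, with winner $\alpha$ and loser $\beta$, associate the matrix $B_n=\mathbb I+E_{\beta\alpha}$, and for $m\le n$ put $Q(m,n)=B_{n-1}\cdots B_m$. Let $m_0=0$ and let $m_{k+1}>m_k$ be the largest integer such that not every letter is the winner of one of the steps from $T(j)$ to $T(j+1)$, $m_k\le j<m_{k+1}$. Put $A(k,\ell)=Q(m_k,m_\ell)$, $A(k)=A(0,k)$, and $\|M\|=\sum_{\alpha,\beta}|M_{\alpha\beta}|$. Condition (A): for every $\varepsilon>0$ there is $C_\varepsilon>0$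 such that $\|A(k,k+1)\|\le C_\varepsilon\|A(k)\|^\varepsilon$ for all $k\ge1$. Condition (D): for every $\varepsilon>0$ there is $C_\varepsilon>0$ such that $\Delta(T^n)\ge C_\varepsilon\, n^{-(1+\varepsilon)}$ for all $n\ge1$, where $\Delta(T^n)$ is the minimum distance between distinct points of $D(T^n)\cup\{0,1\}$, $D(T)=\{p_\alpha:\pi_t(\alpha)>1\}$ and $D(T^n)=\bigcup_{i=0}^{n-1}T^{-i}(D(T))$. Theorem. If $T$ does not satisfy Condition (A), then $T$ does not satisfy Condition (D). Moreover, if $T$ is actually discontinuous (as a map on $[0,1)$) at every $p_\alpha$ with $\pi_t(\alpha)>1$, and $T$ does not satisfy Condition (A), then Condition (D) also fails when $D(T^n)$ is taken to be the set of points of $[0,1)$ at which the map $T^n$ is discontinuous. -/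

import Mathlib

noncomputable section

/-- The map of positions used in a Rauzy move (positions are numbered `0, …, d - 1`): positions up
to `j` stay, positions strictly between `j` and the last one move up by one, and the last position
goes to `j + 1`. (For `j` the last position this is the identity.) -/
def rauzyPos {d : ℕ} (j i : Fin d) : Fin d :=
  if h : i ≤ j then i
  else if h' : (i : ℕ) + 1 < d then ⟨i + 1, h'⟩
  else ⟨j + 1, by have := i.isLt; rw [not_le, Fin.lt_def] at h; omega⟩

theorem rauzyPos_bijective {d : ℕ} (j : Fin d) : Function.Bijective (rauzyPos j) := by
  rw [← Finite.injective_iff_bijective]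
  intro a b hab
  have ha := a.isLt
  have hb := b.isLt
  unfold rauzyPos at hab
  split_ifs at hab <;> simp only [Fin.ext_iff, Fin.le_def] at * <;> omega

/-- `rauzyPos j` as a permutation of the positions. -/
def rauzyPerm {d : ℕ} (j : Fin d) : Equiv.Perm (Fin d) :=
  Equiv.ofBijective (rauzyPos j) (rauzyPos_bijective j)

/-- Combinatorial data `(π_t, π_b)` and length data `(λ_α)` on the alphabet `A`, with `d = #A`.
Positions are numbered from `0` to `d - 1`. -/
structure IETData (A : Type*) [Fintype A] where
  /-- position of a letter before the exchange -/
  top : A ≃ Fin (Fintype.card A)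
  /-- position of a letter after the exchange -/
  bot : A ≃ Fin (Fintype.card A)
  /-- lengths of the subintervals -/
  len : A → ℝ

namespace IETData

section Basic

variable {A : Type*} [Fintype A]

/-- The total length `λ^*`. -/
def total (T : IETData A) : ℝ := ∑ α, T.len α

/-- The interval `I = [0, λ^*)`. -/
def dom (T : IETData A) : Set ℝ := Set.Ico 0 T.total

/-- Left endpoint `p_α` of `I_α`. -/
def topLeft (T : IETData A) (α : A) : ℝ := ∑ β with T.top β < T.top α, T.len β

/-- Left endpoint `q_α` of `T(I_α)`. -/
def botLeft (T : IETData A) (α : A) : ℝ := ∑ β with T.bot β < T.bot α, T.len β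

/-- The subinterval `I_α = [p_α, p_α + λ_α)`. -/
def subint (T : IETData A) (α : A) : Set ℝ :=
  Set.Ico (T.topLeft α) (T.topLeft α + T.len α)

/-- The interval exchange map: `T x = x + q_α - p_α` for `x ∈ I_α`
(and `T x = x` outside `I`, where it is never used). -/
def map (T : IETData A) (x : ℝ) : ℝ :=
  x + ∑ α, (T.subint α).indicator (fun _ => T.botLeft α - T.topLeft α) x

/-- Admissible combinatorial data: for `1 ≤ k ≤ d - 1`, the first `k` letters on the top and the
first `k` letters on the bottom form different sets. -/
def Admissible (T : IETData A) : Prop :=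
  ∀ k : ℕ, 1 ≤ k → k < Fintype.card A →
    {α : A | (T.top α : ℕ) < k} ≠ {α : A | (T.bot α : ℕ) < k}

/-- The Keane property: there are no `α`, `β` and `m ≥ 1` such that `T^m(p_α) = p_β` and `β` is not
the first letter on the top. -/
def Keane (T : IETData A) : Prop :=
  ¬ ∃ (α β : A) (m : ℕ), 1 ≤ m ∧ 0 < (T.top β : ℕ) ∧ T.map^[m] (T.topLeft α) = T.topLeft β

/-- `D(T)`: the points `p_α` with `α` not the first letter on the top. -/
def singularities (T : IETData A) : Set ℝ :=
  {x | ∃ α : A, 0 < (T.top α : ℕ) ∧ x = T.topLeft α}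

/-- `D(T^n) = D(T) ∪ T^{-1}(D(T)) ∪ ⋯ ∪ T^{-(n-1)}(D(T))`. -/
def iterSingularities (T : IETData A) (n : ℕ) : Set ℝ :=
  {x | x ∈ T.dom ∧ ∃ i < n, T.map^[i] x ∈ T.singularities}

/-- The points of `I` at which the map `T^n : I → I` is not continuous in the topological sense. -/
def iterDiscontinuities (T : IETData A) (n : ℕ) : Set ℝ :=
  {x | x ∈ T.dom ∧ ¬ ContinuousWithinAt (T.map^[n]) T.dom x}

/-- The minimum distance between distinct points of the set `S ∪ {0, L}`. -/
def minDist (L : ℝ) (S : Set ℝ) : ℝ :=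
  sInf {r : ℝ | ∃ x ∈ S ∪ {0, L}, ∃ y ∈ S ∪ {0, L}, x ≠ y ∧ r = |x - y|}

/-- Condition (D), with `D(T^n) = ⋃_{i < n} T^{-i} {p_α : α not first on the top}`. -/
def ConditionD (T : IETData A) : Prop :=
  ∀ ε : ℝ, 0 < ε → ∃ C : ℝ, 0 < C ∧ ∀ n : ℕ, 1 ≤ n →
    C / (n : ℝ) ^ (1 + ε) ≤ minDist T.total (T.iterSingularities n)

/-- Condition (D), with `D(T^n)` the set of topological discontinuities of `T^n : I → I`. -/
def ConditionDTop (T : IETData A) : Prop :=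
  ∀ ε : ℝ, 0 < ε → ∃ C : ℝ, 0 < C ∧ ∀ n : ℕ, 1 ≤ n →
    C / (n : ℝ) ^ (1 + ε) ≤ minDist T.total (T.iterDiscontinuities n)

end Basic

section Rauzy

variable {A : Type*} [Fintype A] [DecidableEq A] [Nonempty A]

/-- The letter `α_t`, last on the top. -/
def lastTop (T : IETData A) : A :=
  T.top.symm ⟨Fintype.card A - 1, Nat.sub_lt Fintype.card_pos Nat.one_pos⟩

/-- The letter `α_b`, last on the bottom. -/
def lastBot (T : IETData A) : A :=
  T.bot.symm ⟨Fintype.card A - 1, Nat.sub_lt Fintype.card_pos Nat.one_pos⟩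

/-- The Rauzy–Veech step `𝒱`. It is of top type if `λ_{α_b} < λ_{α_t}` and of bottom type
otherwise. (Equality `λ_{α_t} = λ_{α_b}` never occurs under the Keane property.) -/
def step (T : IETData A) : IETData A :=
  if T.len T.lastBot < T.len T.lastTop then
    { top := T.top
      bot := T.bot.trans (rauzyPerm (T.bot T.lastTop))
      len := Function.update T.len T.lastTop (T.len T.lastTop - T.len T.lastBot) }
  else
    { top := T.top.trans (rauzyPerm (T.top T.lastBot))
      bot := T.bot
      len := Function.update T.len T.lastBot (T.len T.lastBot - T.len T.lastTop) }

/-- The winner of the arrow from `T` to `𝒱(T)`. -/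
def winner (T : IETData A) : A :=
  if T.len T.lastBot < T.len T.lastTop then T.lastTop else T.lastBot

/-- The loser of the arrow from `T` to `𝒱(T)`. -/
def loser (T : IETData A) : A :=
  if T.len T.lastBot < T.len T.lastTop then T.lastBot else T.lastTop

/-- `T(n) = 𝒱^n(T)`. -/
def iter (T : IETData A) (n : ℕ) : IETData A := step^[n] T

/-- The matrix `B_γ = 𝕀 + E_{βα}` of the arrow from `T` to `𝒱(T)`, with winner `α` and
loser `β`. -/
def arrowMatrix (T : IETData A) : Matrix A A ℤ :=
  1 + Matrix.single T.loser T.winner 1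

/-- The cocycle `Q(m, n) = B_{γ(n-1,n)} ⋯ B_{γ(m,m+1)}` for `m ≤ n` (identity for `n ≤ m`). -/
def Q (T : IETData A) (m : ℕ) : ℕ → Matrix A A ℤ
  | 0 => 1
  | n + 1 => if m ≤ n then (T.iter n).arrowMatrix * Q T m n else 1

/-- The Marmi–Moussa–Yoccoz acceleration: `m_0 = 0`, and `m_{k+1} > m_k` is the largest integer such
that not all letters are winners of arrows of the path `γ(m_k, m_{k+1})`. -/
def mmySeq (T : IETData A) : ℕ → ℕ
  | 0 => 0
  | k + 1 => sSup {n : ℕ | mmySeq T k < n ∧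
      ∃ α : A, ∀ j, mmySeq T k ≤ j → j < n → (T.iter j).winner ≠ α}

/-- The Marmi–Moussa–Yoccoz cocycle `A(k, l) = Q(m_k, m_l)`. -/
def mmyMatrix (T : IETData A) (k l : ℕ) : Matrix A A ℤ := T.Q (T.mmySeq k) (T.mmySeq l)

/-- The norm of a matrix: the sum of the absolute values of the entries. -/
def entrySum (M : Matrix A A ℤ) : ℝ := ∑ α, ∑ β, |(M α β : ℝ)|

/-- Condition (A): for all `ε > 0` there is `C > 0` with `‖A(k,k+1)‖ ≤ C ‖A(k)‖^ε` for all
`k ≥ 1`, where `A(k) = A(0,k)`. -/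
def ConditionA (T : IETData A) : Prop :=
  ∀ ε : ℝ, 0 < ε → ∃ C : ℝ, 0 < C ∧ ∀ k : ℕ, 1 ≤ k →
    entrySum (T.mmyMatrix k (k + 1)) ≤ C * entrySum (T.mmyMatrix 0 k) ^ ε

end Rauzy

end IETData

end

/-! Both claims are proved in contrapositive form: (D) implies (A), and (D) for topological
discontinuities implies (D) when T is discontinuous at every singularity.

For the first, T(n) is induced by T with return times `height n`, whose sum H_n equals ‖Q(0,n)‖. The
left endpoints of T(n) are 0 or reach a singularity of T within their return times, so (D) bounds
every length of T(n) below by c·H_n^{-(1+ε)} (`ConditionD.exists_le_len_iter`). The towers have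
total area 1, so height times length is at most 1. A letter that does not win after time m keeps its
length, hence its height stays below a constant times H_m^{1+ε}.

Now suppose that all winners stay in a proper subset X for a long time. By induction on #X every
letter of X wins again and again. When the winner changes, the old winner loses to the new one and
inherits its height, so large heights spread over X. From then on no letter outside X can lose,
because it would become too high. Letters that never lose only move to the right, so eventually
those outside X stand still, and then they precede X in both rows, which Keane forbids. Hence every
letter wins before H exceeds C·H_m^{1+ε} (`ConditionD.exists_complete`). Thus H(m_{k+1}) ≤
C·H(m_k)^{1+δ}, and after a bounded number of accelerated steps all heights are at least H(m_k)/d.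
Comparing ‖A(k,k+1)‖ times the least height with H(m_{k+1}) gives (A).

For the second, let T^i x be a singularity. Then T^{i+1} is discontinuous at x, and a higher iterate
can be continuous there only if T^{i+1} has the one-sided limits 0 and 1 at x. In that case T^{i+1}
turns the distance from x to a nearby point y into the distance from T^{i+1} y to 0 or 1, so no
small distance is lost. -/

namespace IETData

/-! ### Endpoints of consecutive intervals and their behaviour under a Rauzy move -/

section Left

variable {A : Type*} [Fintype A] {d : ℕ}

/-- The left endpoint of the interval of `γ` when intervals of lengths `len` are placed in the
order `e`. -/
def left (e : A ≃ Fin d) (len : A → ℝ) (γ : A) : ℝ := ∑ β with e β < e γ, len β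

theorem left_eq_zero (e : A ≃ Fin d) (len : A → ℝ) {γ : A} (h : (e γ : ℕ) = 0) :
    left e len γ = 0 := by
  unfold left
  rw [Finset.filter_false_of_mem, Finset.sum_empty]
  intro β _ hβ
  rw [Fin.lt_def] at hβ
  omega

theorem left_nonneg (e : A ≃ Fin d) {len : A → ℝ} (hpos : ∀ α, 0 < len α) (γ : A) :
    0 ≤ left e len γ :=
  Finset.sum_nonneg fun β _ => (hpos β).le

theorem left_pos (e : A ≃ Fin d) {len : A → ℝ} (hpos : ∀ α, 0 < len α) {γ : A}
    (h : 0 < (e γ : ℕ)) : 0 < left e len γ := by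
  refine Finset.sum_pos (fun β _ => hpos β) ⟨e.symm ⟨0, by have := (e γ).isLt; omega⟩, ?_⟩
  rw [Finset.mem_filter, Equiv.apply_symm_apply, Fin.lt_def]
  exact ⟨Finset.mem_univ _, h⟩

theorem left_add_len [DecidableEq A] (e : A ≃ Fin d) (len : A → ℝ) (γ : A) :
    left e len γ + len γ = ∑ β with e β ≤ e γ, len β := by
  have : (Finset.univ.filter fun β => e β ≤ e γ) =
      insert γ (Finset.univ.filter fun β => e β < e γ) := by
    ext β
    simp only [Finset.mem_filter, Finset.mem_univ, true_and, Finset.mem_insert]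
    rw [le_iff_eq_or_lt, e.injective.eq_iff]
  rw [this, Finset.sum_insert (by simp), left, add_comm]

theorem left_add_len_le (e : A ≃ Fin d) {len : A → ℝ} (hpos : ∀ α, 0 < len α) {β γ : A}
    (h : e β < e γ) : left e len β + len β ≤ left e len γ := by
  classical
  rw [left_add_len]
  exact Finset.sum_le_sum_of_subset_of_nonneg
    (Finset.monotone_filter_right _ fun x _ hx => lt_of_le_of_lt hx h) fun x _ _ => (hpos x).le

theorem left_add_len_le_sum (e : A ≃ Fin d) {len : A → ℝ} (hpos : ∀ α, 0 < len α) (γ : A) :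
    left e len γ + len γ ≤ ∑ β, len β := by
  classical
  rw [left_add_len]
  exact Finset.sum_le_sum_of_subset_of_nonneg (Finset.filter_subset _ _) fun x _ _ => (hpos x).le

theorem left_add_len_last (e : A ≃ Fin d) (len : A → ℝ) {γ : A} (h : (e γ : ℕ) + 1 = d) :
    left e len γ + len γ = ∑ β, len β := by
  classical
  rw [left_add_len, Finset.filter_true_of_mem]
  intro β _
  have := (e β).isLt
  rw [Fin.le_def]
  omega

theorem left_next (e : A ≃ Fin d) (len : A → ℝ) {γ δ : A} (h : (e δ : ℕ) = e γ + 1) :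
    left e len δ = left e len γ + len γ := by
  classical
  rw [left_add_len, left]
  congr 1
  ext β
  simp only [Finset.mem_filter, Finset.mem_univ, true_and, Fin.le_def, Fin.lt_def]
  omega

theorem exists_next {B : Type*} (e : B ≃ Fin d) {γ : B} (h : (e γ : ℕ) + 1 ≠ d) :
    ∃ δ, (e δ : ℕ) = e γ + 1 :=
  ⟨e.symm ⟨e γ + 1, by have := (e γ).isLt; omega⟩, by simp⟩

theorem exists_mem_Ico_left (e : A ≃ Fin d) {len : A → ℝ} {x : ℝ}
    (hx : x ∈ Set.Ico 0 (∑ β, len β)) :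
    ∃ γ, x ∈ Set.Ico (left e len γ) (left e len γ + len γ) := by
  by_contra! hcon
  have hd : ∀ k (hk : k < d), left e len (e.symm ⟨k, hk⟩) ≤ x := by
    intro k
    induction k with
    | zero => intro hk; rw [left_eq_zero e len (by simp)]; exact hx.1
    | succ k ih =>
      intro hk
      have h1 := ih (by omega)
      have h2 := hcon (e.symm ⟨k, by omega⟩)
      rw [left_next e len (γ := e.symm ⟨k, by omega⟩) (by simp)]
      by_contra h3
      exact h2 ⟨h1, not_le.mp h3⟩
  rcases Nat.eq_zero_or_pos d with h0 | h0
  · subst h0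
    have : IsEmpty A := e.isEmpty
    simp at hx
  · have h1 := hd (d - 1) (by omega)
    have h2 := hcon (e.symm ⟨d - 1, by omega⟩)
    refine h2 ⟨h1, ?_⟩
    rw [left_add_len_last e len (by simp; omega)]
    exact hx.2

theorem eq_of_mem_Ico_left (e : A ≃ Fin d) {len : A → ℝ} (hpos : ∀ α, 0 < len α) {x : ℝ}
    {β γ : A} (hβ : x ∈ Set.Ico (left e len β) (left e len β + len β))
    (hγ : x ∈ Set.Ico (left e len γ) (left e len γ + len γ)) : β = γ := by
  by_contra hne
  rcases lt_or_gt_of_ne (e.injective.ne hne) with h' | h'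
  · linarith [left_add_len_le e hpos h', hβ.2, hγ.1]
  · linarith [left_add_len_le e hpos h', hγ.2, hβ.1]

theorem rauzyPos_of_le {j i : Fin d} (h : i ≤ j) : rauzyPos j i = i := by
  simp [rauzyPos, h]

theorem rauzyPos_val_of_lt {j i : Fin d} (h : j < i) (h' : (i : ℕ) + 1 < d) :
    (rauzyPos j i : ℕ) = i + 1 := by
  simp [rauzyPos, not_le.mpr h, h']

theorem rauzyPos_val_last {j i : Fin d} (h : j < i) (h' : (i : ℕ) + 1 = d) :
    (rauzyPos j i : ℕ) = j + 1 := by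
  simp [rauzyPos, not_le.mpr h, h']

theorem rauzyPos_lt_iff {j a b : Fin d} (ha : (a : ℕ) + 1 ≠ d) (hb : (b : ℕ) + 1 ≠ d) :
    rauzyPos j a < rauzyPos j b ↔ a < b := by
  have h1 := a.isLt
  have h2 := b.isLt
  rcases le_or_gt a j with h | h <;> rcases le_or_gt b j with h' | h'
  · rw [rauzyPos_of_le h, rauzyPos_of_le h']
  · rw [rauzyPos_of_le h, Fin.lt_def, rauzyPos_val_of_lt h' (by omega), Fin.lt_def]
    rw [Fin.le_def] at h; rw [Fin.lt_def] at h'; omega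
  · rw [rauzyPos_of_le h', Fin.lt_def, rauzyPos_val_of_lt h (by omega), Fin.lt_def]
    rw [Fin.le_def] at h'; rw [Fin.lt_def] at h; omega
  · rw [Fin.lt_def, rauzyPos_val_of_lt h (by omega), rauzyPos_val_of_lt h' (by omega), Fin.lt_def]
    omega

theorem le_rauzyPos {j a : Fin d} (ha : (a : ℕ) + 1 ≠ d) : a ≤ rauzyPos j a := by
  have h1 := a.isLt
  rcases le_or_gt a j with h | h
  · rw [rauzyPos_of_le h]
  · rw [Fin.le_def, rauzyPos_val_of_lt h (by omega)]; omega

theorem rauzyPos_lt_last_iff {j a l : Fin d} (hl : (l : ℕ) + 1 = d) (hj : j ≠ l) (ha : a ≠ l) :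
    rauzyPos j a < rauzyPos j l ↔ a ≤ j := by
  have h1 := a.isLt
  have h2 := j.isLt
  have hj' : (j : ℕ) ≠ l := fun h => hj (Fin.ext h)
  have ha' : (a : ℕ) ≠ l := fun h => ha (Fin.ext h)
  rw [Fin.lt_def, rauzyPos_val_last (by rw [Fin.lt_def]; omega) hl]
  rcases le_or_gt a j with h | h
  · rw [rauzyPos_of_le h]; simp only [h, iff_true]; rw [Fin.le_def] at h; omega
  · rw [rauzyPos_val_of_lt h (by omega)]
    simp only [not_le.mpr h, iff_false]; rw [Fin.lt_def] at h; omega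

theorem last_lt_rauzyPos_iff {j a l : Fin d} (hl : (l : ℕ) + 1 = d) (hj : j ≠ l) (ha : a ≠ l) :
    rauzyPos j l < rauzyPos j a ↔ j < a := by
  have h := rauzyPos_lt_last_iff hl hj ha
  have hne : rauzyPos j a ≠ rauzyPos j l := (rauzyPos_bijective j).1.ne ha
  rw [← not_iff_not, not_lt, not_lt, ← h]
  exact ⟨fun h' => lt_of_le_of_ne h' hne, le_of_lt⟩

variable [DecidableEq A]

theorem left_update_last (e : A ≃ Fin d) (len : A → ℝ) {w : A} (hw : (e w : ℕ) + 1 = d) (c : ℝ)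
    (γ : A) : left e (Function.update len w c) γ = left e len γ := by
  refine Finset.sum_congr rfl fun β hβ => ?_
  rw [Function.update_of_ne]
  rintro rfl
  simp only [Finset.mem_filter, Finset.mem_univ, true_and, Fin.lt_def] at hβ
  have := (e γ).isLt
  omega

/-- The length that `w` gives up is filled by `l`, inserted directly after it, so nothing further to
the right shifts. -/
theorem left_rauzy_of_ne (e : A ≃ Fin d) (len : A → ℝ) {w l γ : A} (hl : (e l : ℕ) + 1 = d)
    (hwl : w ≠ l) (hγ : γ ≠ l) :
    left (e.trans (rauzyPerm (e w))) (Function.update len w (len w - len l)) γ =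
      left e len γ := by
  have hne : ∀ a, a ≠ l → (e a : ℕ) + 1 ≠ d := fun a ha h =>
    ha (e.injective (Fin.ext (by omega)))
  have key : ∀ β, (if (e.trans (rauzyPerm (e w))) β < (e.trans (rauzyPerm (e w))) γ then
      Function.update len w (len w - len l) β else 0) =
      (if e β < e γ then len β else 0) + (if β = l then (if e w < e γ then len l else 0) else 0)
        - (if β = w then (if e w < e γ then len l else 0) else 0) := by
    intro β
    change (if rauzyPos (e w) (e β) < rauzyPos (e w) (e γ) then _ else _) = _
    by_cases hβ : β = l
    · subst hβ
      rw [if_neg hwl.symm, if_pos rfl, Function.update_of_ne hwl.symm]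
      have := last_lt_rauzyPos_iff hl (e.injective.ne hwl) (e.injective.ne hγ)
      have h0 : ¬ e β < e γ := by rw [Fin.lt_def]; have := (e γ).isLt; omega
      simp only [this, h0]
      simp
    · rw [if_neg hβ]
      have := rauzyPos_lt_iff (j := e w) (hne β hβ) (hne γ hγ)
      simp only [this]
      by_cases hβw : β = w
      · subst hβw; by_cases h : e β < e γ <;> simp [h]
      · simp [hβw]
  unfold left
  rw [Finset.sum_filter, Finset.sum_congr rfl fun β _ => key β, Finset.sum_sub_distrib,
    Finset.sum_add_distrib, Finset.sum_ite_eq', Finset.sum_ite_eq', Finset.sum_filter]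
  simp

theorem left_rauzy_last (e : A ≃ Fin d) (len : A → ℝ) {w l : A} (hl : (e l : ℕ) + 1 = d)
    (hwl : w ≠ l) :
    left (e.trans (rauzyPerm (e w))) (Function.update len w (len w - len l)) l =
      left e len w + len w - len l := by
  have : (Finset.univ.filter fun β =>
      (e.trans (rauzyPerm (e w))) β < (e.trans (rauzyPerm (e w))) l) =
      Finset.univ.filter fun β => e β ≤ e w := by
    ext β
    simp only [Finset.mem_filter, Finset.mem_univ, true_and]
    by_cases hβ : β = l
    · subst hβ
      simp only [lt_self_iff_false, false_iff, not_le, Fin.lt_def]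
      have h1 := (e w).isLt
      have h2 : (e w : ℕ) ≠ e β := fun h => hwl (e.injective (Fin.ext h))
      omega
    · exact rauzyPos_lt_last_iff hl (e.injective.ne hwl) (e.injective.ne hβ)
  rw [left_add_len, left, this, ← Finset.add_sum_erase _ _ (a := w) (by simp),
    ← Finset.add_sum_erase _ len (a := w) (by simp), Function.update_self]
  rw [Finset.sum_congr rfl fun β hβ => Function.update_of_ne (Finset.ne_of_mem_erase hβ) _ _]
  ring

end Left
-- The interval exchange map on its domain
section Map

variable {A : Type*} [Fintype A] {S : IETData A}

theorem exists_mem_subint {x : ℝ} (hx : x ∈ S.dom) : ∃ γ, x ∈ S.subint γ :=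
  exists_mem_Ico_left S.top hx

theorem eq_of_mem_subint (hpos : ∀ α, 0 < S.len α) {x : ℝ} {β γ : A} (hβ : x ∈ S.subint β)
    (hγ : x ∈ S.subint γ) : β = γ :=
  eq_of_mem_Ico_left S.top hpos hβ hγ

theorem map_of_mem_subint (hpos : ∀ α, 0 < S.len α) {x : ℝ} {γ : A} (hx : x ∈ S.subint γ) :
    S.map x = x + (S.botLeft γ - S.topLeft γ) := by
  unfold map
  rw [Finset.sum_eq_single γ]
  · rw [Set.indicator_of_mem hx]
  · intro β _ hβ
    exact Set.indicator_of_notMem (fun h => hβ (eq_of_mem_subint hpos h hx)) _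
  · simp

theorem topLeft_mem_subint (hpos : ∀ α, 0 < S.len α) (γ : A) : S.topLeft γ ∈ S.subint γ :=
  ⟨le_rfl, by linarith [hpos γ]⟩

theorem subint_subset_dom (hpos : ∀ α, 0 < S.len α) (γ : A) : S.subint γ ⊆ S.dom := fun _ hx =>
  ⟨(left_nonneg S.top hpos γ).trans hx.1, hx.2.trans_le (left_add_len_le_sum S.top hpos γ)⟩

theorem map_topLeft (hpos : ∀ α, 0 < S.len α) (γ : A) : S.map (S.topLeft γ) = S.botLeft γ := by
  rw [map_of_mem_subint hpos (topLeft_mem_subint hpos γ)]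
  ring

theorem map_mem_Ico (hpos : ∀ α, 0 < S.len α) {x : ℝ} {γ : A} (hx : x ∈ S.subint γ) :
    S.map x ∈ Set.Ico (S.botLeft γ) (S.botLeft γ + S.len γ) := by
  rw [map_of_mem_subint hpos hx]
  exact ⟨by linarith [hx.1], by linarith [hx.2]⟩

theorem map_mem_dom (hpos : ∀ α, 0 < S.len α) {x : ℝ} (hx : x ∈ S.dom) : S.map x ∈ S.dom := by
  obtain ⟨γ, hγ⟩ := exists_mem_subint hx
  have := map_mem_Ico hpos hγ
  exact ⟨(left_nonneg S.bot hpos γ).trans this.1,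
    this.2.trans_le (left_add_len_le_sum S.bot hpos γ)⟩

theorem iterate_mem_dom (hpos : ∀ α, 0 < S.len α) {x : ℝ} (hx : x ∈ S.dom) (n : ℕ) :
    S.map^[n] x ∈ S.dom := by
  induction n with
  | zero => exact hx
  | succ n ih => rw [Function.iterate_succ_apply']; exact map_mem_dom hpos ih

theorem map_injOn (hpos : ∀ α, 0 < S.len α) : Set.InjOn S.map S.dom := by
  intro x hx y hy hxy
  obtain ⟨γ, hγ⟩ := exists_mem_subint hx
  obtain ⟨δ, hδ⟩ := exists_mem_subint hy
  have h1 := map_mem_Ico hpos hγ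
  have h2 := map_mem_Ico hpos hδ
  rw [hxy] at h1
  have : γ = δ := eq_of_mem_Ico_left S.bot hpos h1 h2
  subst this
  rw [map_of_mem_subint hpos hγ, map_of_mem_subint hpos hδ] at hxy
  linarith

theorem singularities_subset_dom (hpos : ∀ α, 0 < S.len α) : S.singularities ⊆ S.dom := by
  rintro x ⟨α, _, rfl⟩
  exact subint_subset_dom hpos α (topLeft_mem_subint hpos α)

end Map

/-! ### One Rauzy–Veech step: lengths and endpoints -/

section Step

variable {A : Type*} [Fintype A] [Nonempty A] {S : IETData A}

theorem top_lastTop (S : IETData A) : (S.top S.lastTop : ℕ) + 1 = Fintype.card A := by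
  have : 0 < Fintype.card A := Fintype.card_pos
  simp [lastTop]
  omega

theorem bot_lastBot (S : IETData A) : (S.bot S.lastBot : ℕ) + 1 = Fintype.card A := by
  have : 0 < Fintype.card A := Fintype.card_pos
  simp [lastBot]
  omega

theorem topLeft_lastTop_add (S : IETData A) :
    S.topLeft S.lastTop + S.len S.lastTop = S.total :=
  left_add_len_last S.top S.len S.top_lastTop

theorem botLeft_lastBot_add (S : IETData A) :
    S.botLeft S.lastBot + S.len S.lastBot = S.total :=
  left_add_len_last S.bot S.len S.bot_lastBot

theorem winner_of_lt (h : S.len S.lastBot < S.len S.lastTop) : S.winner = S.lastTop := if_pos h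
theorem loser_of_lt (h : S.len S.lastBot < S.len S.lastTop) : S.loser = S.lastBot := if_pos h
theorem winner_of_not_lt (h : ¬ S.len S.lastBot < S.len S.lastTop) : S.winner = S.lastBot :=
  if_neg h
theorem loser_of_not_lt (h : ¬ S.len S.lastBot < S.len S.lastTop) : S.loser = S.lastTop := if_neg h

theorem winner_eq_or (S : IETData A) : S.winner = S.lastTop ∧ S.loser = S.lastBot ∨
    S.winner = S.lastBot ∧ S.loser = S.lastTop := by
  by_cases h : S.len S.lastBot < S.len S.lastTop
  · exact .inl ⟨winner_of_lt h, loser_of_lt h⟩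
  · exact .inr ⟨winner_of_not_lt h, loser_of_not_lt h⟩

theorem winner_ne_loser (h : S.lastTop ≠ S.lastBot) : S.winner ≠ S.loser := by
  rcases S.winner_eq_or with ⟨h1, h2⟩ | ⟨h1, h2⟩
  · rwa [h1, h2]
  · rw [h1, h2]; exact h.symm

variable [DecidableEq A]

theorem step_top_of_lt (h : S.len S.lastBot < S.len S.lastTop) : S.step.top = S.top := by
  rw [step, if_pos h]

theorem step_bot_of_lt (h : S.len S.lastBot < S.len S.lastTop) :
    S.step.bot = S.bot.trans (rauzyPerm (S.bot S.lastTop)) := by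
  rw [step, if_pos h]

theorem step_top_of_not_lt (h : ¬ S.len S.lastBot < S.len S.lastTop) :
    S.step.top = S.top.trans (rauzyPerm (S.top S.lastBot)) := by
  rw [step, if_neg h]

theorem step_bot_of_not_lt (h : ¬ S.len S.lastBot < S.len S.lastTop) : S.step.bot = S.bot := by
  rw [step, if_neg h]

theorem step_len (S : IETData A) :
    S.step.len = Function.update S.len S.winner (S.len S.winner - S.len S.loser) := by
  by_cases h : S.len S.lastBot < S.len S.lastTop
  · rw [winner_of_lt h, loser_of_lt h, step, if_pos h]
  · rw [winner_of_not_lt h, loser_of_not_lt h, step, if_neg h]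

theorem step_topLeft_of_lt (h : S.len S.lastBot < S.len S.lastTop) (γ : A) :
    S.step.topLeft γ = S.topLeft γ := by
  change left S.step.top S.step.len γ = left S.top S.len γ
  rw [step_top_of_lt h, step_len, winner_of_lt h]
  exact left_update_last _ _ S.top_lastTop _ _

theorem step_botLeft_of_not_lt (h : ¬ S.len S.lastBot < S.len S.lastTop) (γ : A) :
    S.step.botLeft γ = S.botLeft γ := by
  change left S.step.bot S.step.len γ = left S.bot S.len γ
  rw [step_bot_of_not_lt h, step_len, winner_of_not_lt h]
  exact left_update_last _ _ S.bot_lastBot _ _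

theorem step_botLeft_lastBot_of_lt (hne : S.lastTop ≠ S.lastBot)
    (h : S.len S.lastBot < S.len S.lastTop) :
    S.step.botLeft S.lastBot = S.botLeft S.lastTop + S.len S.lastTop - S.len S.lastBot := by
  change left S.step.bot S.step.len _ = left S.bot S.len _ + _ - _
  rw [step_bot_of_lt h, step_len, winner_of_lt h, loser_of_lt h]
  exact left_rauzy_last _ _ S.bot_lastBot hne

theorem step_topLeft_lastTop_of_not_lt (hne : S.lastTop ≠ S.lastBot)
    (h : ¬ S.len S.lastBot < S.len S.lastTop) :
    S.step.topLeft S.lastTop = S.topLeft S.lastBot + S.len S.lastBot - S.len S.lastTop := by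
  change left S.step.top S.step.len _ = left S.top S.len _ + _ - _
  rw [step_top_of_not_lt h, step_len, winner_of_not_lt h, loser_of_not_lt h]
  exact left_rauzy_last _ _ S.top_lastTop hne.symm

theorem step_topLeft_of_ne (hne : S.lastTop ≠ S.lastBot) {γ : A} (hγ : γ ≠ S.loser) :
    S.step.topLeft γ = S.topLeft γ := by
  by_cases h : S.len S.lastBot < S.len S.lastTop
  · exact step_topLeft_of_lt h γ
  · change left S.step.top S.step.len _ = left S.top S.len _
    rw [loser_of_not_lt h] at hγ
    rw [step_top_of_not_lt h, step_len, winner_of_not_lt h, loser_of_not_lt h]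
    exact left_rauzy_of_ne _ _ S.top_lastTop hne.symm hγ

theorem step_botLeft_of_ne (hne : S.lastTop ≠ S.lastBot) {γ : A} (hγ : γ ≠ S.loser) :
    S.step.botLeft γ = S.botLeft γ := by
  by_cases h : S.len S.lastBot < S.len S.lastTop
  · change left S.step.bot S.step.len _ = left S.bot S.len _
    rw [loser_of_lt h] at hγ
    rw [step_bot_of_lt h, step_len, winner_of_lt h, loser_of_lt h]
    exact left_rauzy_of_ne _ _ S.bot_lastBot hne hγ
  · exact step_botLeft_of_not_lt h γ

theorem step_total (S : IETData A) : S.step.total = S.total - S.len S.loser := by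
  unfold total
  rw [step_len, Finset.sum_update_of_mem (Finset.mem_univ _),
    ← Finset.add_sum_erase _ S.len (Finset.mem_univ S.winner), Finset.sdiff_singleton_eq_erase]
  ring

/-- After a step the winner is still the last letter of its row, so it loses to a new winner. -/
theorem loser_step (h : S.step.winner ≠ S.winner) :
    S.step.loser = S.winner := by
  by_cases hlt : S.len S.lastBot < S.len S.lastTop
  · have : S.step.lastTop = S.lastTop := by simp only [lastTop, step_top_of_lt hlt]
    rw [winner_of_lt hlt] at h ⊢
    rcases S.step.winner_eq_or with ⟨h1, h2⟩ | ⟨h1, h2⟩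
    · exact absurd (h1.trans this) h
    · exact h2.trans this
  · have : S.step.lastBot = S.lastBot := by simp only [lastBot, step_bot_of_not_lt hlt]
    rw [winner_of_not_lt hlt] at h ⊢
    rcases S.step.winner_eq_or with ⟨h1, h2⟩ | ⟨h1, h2⟩
    · exact h2.trans this
    · exact absurd (h1.trans this) h

end Step

/-! ### Induced exchanges, return times and the Keane property -/

/-- `S` is induced by `T` with return times `h`. -/
structure IsInduced {A : Type*} [Fintype A] (T S : IETData A) (h : A → ℕ) : Prop where
  pos : ∀ α, 0 < S.len α
  total_le : S.total ≤ T.total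
  time_pos : ∀ α, 0 < h α
  iterate_eq : ∀ γ, ∀ x ∈ S.subint γ, T.map^[h γ] x = x + (S.botLeft γ - S.topLeft γ)
  hits : ∀ γ, 0 < (S.top γ : ℕ) → ∃ i < h γ, T.map^[i] (S.topLeft γ) ∈ T.singularities

section Induced

variable {A : Type*} [Fintype A] {T S : IETData A} {h : A → ℕ}

theorem isInduced_self (hpos : ∀ α, 0 < T.len α) : IsInduced T T fun _ => 1 where
  pos := hpos
  total_le := le_rfl
  time_pos _ := one_pos
  iterate_eq _ _ hx := map_of_mem_subint hpos hx
  hits γ hγ := ⟨0, one_pos, γ, hγ, rfl⟩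

theorem IsInduced.mem_dom (hS : IsInduced T S h) {x : ℝ} {γ : A} (hx : x ∈ S.subint γ) :
    x ∈ T.dom :=
  have := subint_subset_dom hS.pos γ hx
  ⟨this.1, this.2.trans_le hS.total_le⟩

theorem Keane.not_hits_twice (hk : T.Keane) {x : ℝ} {i j : ℕ} (hij : i < j)
    (hi : T.map^[i] x ∈ T.singularities) : T.map^[j] x ∉ T.singularities := by
  rintro ⟨β, hβ, hj⟩
  obtain ⟨α, hα, hi⟩ := hi
  refine hk ⟨α, β, j - i, by omega, hβ, ?_⟩
  rw [← hi, ← hj, ← Function.iterate_add_apply]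
  congr 2
  omega

theorem Keane.eq_of_hits (hk : T.Keane) {x : ℝ} {i j : ℕ}
    (hi : T.map^[i] x ∈ T.singularities) (hj : T.map^[j] x ∈ T.singularities) : i = j := by
  rcases lt_trichotomy i j with h | h | h
  · exact absurd hj (hk.not_hits_twice h hi)
  · exact h
  · exact absurd hi (hk.not_hits_twice h hj)

theorem topLeft_of_zero (S : IETData A) {γ : A} (h : (S.top γ : ℕ) = 0) : S.topLeft γ = 0 :=
  left_eq_zero S.top S.len h

theorem Keane.zero_not_hits [Nonempty A] (hk : T.Keane) {i : ℕ} (hi : 1 ≤ i) :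
    T.map^[i] 0 ∉ T.singularities := by
  rintro ⟨β, hβ, h⟩
  refine hk ⟨T.top.symm ⟨0, Fintype.card_pos⟩, β, i, hi, hβ, ?_⟩
  rw [topLeft_of_zero _ (by simp), h]

/-- Otherwise the orbit of the left endpoint of `γ` passes through that of `γ'` at time `h γ` and
meets a singularity of `T` from then on. But it has already met one before time `h γ`, or it starts
at 0; Keane excludes both. This is the only form in which Keane enters the combinatorics of the
induction: it rules out ties and invariant initial segments. -/
theorem IsInduced.botLeft_ne_topLeft [Nonempty A] (hS : IsInduced T S h) (hk : T.Keane)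
    {γ γ' : A} (hγ' : 0 < (S.top γ' : ℕ)) : S.botLeft γ ≠ S.topLeft γ' := by
  intro heq
  have h1 : T.map^[h γ] (S.topLeft γ) = S.topLeft γ' := by
    rw [hS.iterate_eq γ _ (topLeft_mem_subint hS.pos γ), ← heq]
    ring
  obtain ⟨i, -, hi⟩ := hS.hits γ' hγ'
  rw [← h1, ← Function.iterate_add_apply] at hi
  have hpos := hS.time_pos γ
  rcases Nat.eq_zero_or_pos (S.top γ : ℕ) with h0 | h0
  · rw [topLeft_of_zero S h0] at hi
    exact hk.zero_not_hits (by omega) hi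
  · obtain ⟨j, hj, hj'⟩ := hS.hits γ h0
    exact hk.not_hits_twice (by omega) hj' hi

end Induced

section InducedStep

variable {A : Type*} [Fintype A] [Nontrivial A] {T S : IETData A} {h : A → ℕ}

theorem top_lastTop_pos (S : IETData A) : 0 < (S.top S.lastTop : ℕ) := by
  have h1 := S.top_lastTop
  have h2 := Fintype.one_lt_card (α := A)
  omega

theorem IsInduced.lastTop_ne_lastBot (hS : IsInduced T S h) (hk : T.Keane) :
    S.lastTop ≠ S.lastBot := by
  intro heq
  apply hS.botLeft_ne_topLeft hk (γ := S.lastBot) S.top_lastTop_pos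
  have h1 := S.topLeft_lastTop_add
  have h2 := S.botLeft_lastBot_add
  rw [heq] at h1 ⊢
  linarith

theorem IsInduced.loser_lt_winner (hS : IsInduced T S h) (hk : T.Keane) :
    S.len S.loser < S.len S.winner := by
  by_cases hlt : S.len S.lastBot < S.len S.lastTop
  · rwa [winner_of_lt hlt, loser_of_lt hlt]
  · rw [winner_of_not_lt hlt, loser_of_not_lt hlt]
    refine lt_of_le_of_ne (not_lt.mp hlt) fun heq => ?_
    apply hS.botLeft_ne_topLeft hk (γ := S.lastBot) S.top_lastTop_pos
    have h1 := S.topLeft_lastTop_add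
    have h2 := S.botLeft_lastBot_add
    linarith

variable [DecidableEq A]

theorem IsInduced.step (hS : IsInduced T S h) (hk : T.Keane) :
    IsInduced T S.step (Function.update h S.loser (h S.loser + h S.winner)) := by
  have hne := hS.lastTop_ne_lastBot hk
  have hwl := winner_ne_loser hne
  have hlt' := hS.loser_lt_winner hk
  have htop := S.topLeft_lastTop_add
  have hbot := S.botLeft_lastBot_add
  have hlenpos : ∀ α, 0 < S.step.len α := by
    intro α
    rw [step_len]
    by_cases hα : α = S.winner
    · subst hα; rw [Function.update_self]; linarith
    · rw [Function.update_of_ne hα]; exact hS.pos α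
  have hlen : ∀ α, S.step.len α ≤ S.len α := by
    intro α
    rw [step_len]
    by_cases hα : α = S.winner
    · subst hα; rw [Function.update_self]; linarith [hS.pos S.loser]
    · rw [Function.update_of_ne hα]
  have hlenl : S.step.len S.loser = S.len S.loser := by
    rw [step_len, Function.update_of_ne hwl.symm]
  refine ⟨hlenpos, ?_, ?_, ?_, ?_⟩
  · rw [step_total]; linarith [hS.total_le, hS.pos S.loser]
  · intro α
    by_cases hα : α = S.loser
    · subst hα; rw [Function.update_self]; have := hS.time_pos S.loser; omega
    · rw [Function.update_of_ne hα]; exact hS.time_pos α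
  · intro γ x hx
    by_cases hγ : γ = S.loser
    · subst hγ
      rw [Function.update_self]
      obtain ⟨hx1, hx2⟩ := hx
      rw [hlenl] at hx2
      by_cases hlt : S.len S.lastBot < S.len S.lastTop
      · have e1 := step_topLeft_of_lt hlt S.lastBot
        have e2 := step_botLeft_lastBot_of_lt hne hlt
        rw [winner_of_lt hlt, loser_of_lt hlt] at *
        rw [e1] at hx1 hx2
        -- Top type: the loser's own branch sends its interval to the right end of the domain, which
        -- is being cut off and lies in the winner's interval; the winner's branch follows.
        rw [add_comm (h _), Function.iterate_add_apply, hS.iterate_eq _ x ⟨hx1, hx2⟩,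
          hS.iterate_eq S.lastTop]
        · rw [e1, e2]; linarith
        · exact ⟨by linarith, by linarith⟩
      · have e1 := step_topLeft_lastTop_of_not_lt hne hlt
        have e2 := step_botLeft_of_not_lt hlt S.lastTop
        rw [winner_of_not_lt hlt, loser_of_not_lt hlt] at *
        rw [e1] at hx1 hx2
        -- Bottom type: the loser's new interval is the right end of the winner's old one, so the
        -- winner's branch comes first.
        rw [Function.iterate_add_apply, hS.iterate_eq S.lastBot x ⟨by linarith, by linarith⟩,
          hS.iterate_eq S.lastTop]
        · rw [e1, e2]; linarith
        · exact ⟨by linarith, by linarith⟩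
    · rw [Function.update_of_ne hγ, step_topLeft_of_ne hne hγ, step_botLeft_of_ne hne hγ]
      refine hS.iterate_eq γ x ?_
      obtain ⟨hx1, hx2⟩ := hx
      rw [step_topLeft_of_ne hne hγ] at hx1 hx2
      exact ⟨hx1, by linarith [hlen γ]⟩
  · intro γ hγ
    by_cases hlt : S.len S.lastBot < S.len S.lastTop
    · rw [step_top_of_lt hlt] at hγ
      obtain ⟨i, hi, hi'⟩ := hS.hits γ hγ
      rw [step_topLeft_of_lt hlt]
      refine ⟨i, hi.trans_le ?_, hi'⟩
      by_cases hγ : γ = S.loser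
      · subst hγ; rw [Function.update_self]; omega
      · rw [Function.update_of_ne hγ]
    · by_cases hγl : γ = S.loser
      · subst hγl
        rw [Function.update_self]
        obtain ⟨i, hi, hi'⟩ := hS.hits S.lastTop S.top_lastTop_pos
        have e1 := step_topLeft_lastTop_of_not_lt hne hlt
        rw [winner_of_not_lt hlt, loser_of_not_lt hlt] at *
        -- The winner's branch takes the new left endpoint of the loser to its old one, which hits
        -- after `i` more steps.
        refine ⟨i + h S.lastBot, by omega, ?_⟩
        rw [Function.iterate_add_apply, e1, hS.iterate_eq S.lastBot]
        · convert hi' using 2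
          linarith
        · exact ⟨by linarith, by linarith [hS.pos S.lastTop]⟩
      · rw [Function.update_of_ne hγl, step_topLeft_of_ne hne hγl]
        refine hS.hits γ ?_
        by_contra h0
        have h0 : (S.top γ : ℕ) = 0 := by omega
        rw [step_top_of_not_lt hlt] at hγ
        change 0 < (rauzyPos _ (S.top γ) : ℕ) at hγ
        rw [rauzyPos_of_le (by rw [Fin.le_def]; omega)] at hγ
        omega

end InducedStep

/-! ### Return times and the matrix cocycle -/

section Height

variable {A : Type*} [Fintype A] [DecidableEq A] [Nonempty A]

/-- The return time to the domain of `T(n)` of the points of the interval `I_α(n)`. -/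
noncomputable def height (T : IETData A) : ℕ → A → ℕ
  | 0 => fun _ => 1
  | n + 1 => Function.update (height T n) (T.iter n).loser
      (height T n (T.iter n).loser + height T n (T.iter n).winner)

/-- The sum of the return times. -/
noncomputable def heightSum (T : IETData A) (n : ℕ) : ℕ := ∑ α, T.height n α

variable (T : IETData A)

theorem iter_succ (n : ℕ) : T.iter (n + 1) = (T.iter n).step :=
  Function.iterate_succ_apply' step n T

theorem height_succ_loser (n : ℕ) : T.height (n + 1) (T.iter n).loser =
    T.height n (T.iter n).loser + T.height n (T.iter n).winner := by
  rw [height, Function.update_self]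

theorem height_succ_of_ne {n : ℕ} {α : A} (h : α ≠ (T.iter n).loser) :
    T.height (n + 1) α = T.height n α := by
  rw [height, Function.update_of_ne h]

theorem height_mono (α : A) : Monotone fun n => T.height n α := by
  refine monotone_nat_of_le_succ fun n => ?_
  by_cases h : α = (T.iter n).loser
  · subst h; rw [height_succ_loser]; omega
  · rw [height_succ_of_ne T h]

theorem height_pos (n : ℕ) (α : A) : 0 < T.height n α :=
  lt_of_lt_of_le one_pos (T.height_mono α (Nat.zero_le n))

theorem heightSum_succ (n : ℕ) :
    T.heightSum (n + 1) = T.heightSum n + T.height n (T.iter n).winner := by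
  unfold heightSum
  rw [height, Finset.sum_update_of_mem (Finset.mem_univ _),
    ← Finset.add_sum_erase _ (T.height n) (Finset.mem_univ (T.iter n).loser),
    Finset.sdiff_singleton_eq_erase]
  ring

theorem height_le_heightSum (n : ℕ) (α : A) : T.height n α ≤ T.heightSum n :=
  Finset.single_le_sum (f := T.height n) (fun _ _ => Nat.zero_le _) (Finset.mem_univ α)

theorem heightSum_succ_le (n : ℕ) : T.heightSum (n + 1) ≤ 2 * T.heightSum n := by
  have := T.height_le_heightSum n (T.iter n).winner
  rw [heightSum_succ]
  omega

theorem heightSum_strictMono : StrictMono T.heightSum := by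
  refine strictMono_nat_of_lt_succ fun n => ?_
  have := T.height_pos n (T.iter n).winner
  rw [heightSum_succ]
  omega

theorem heightSum_pos (n : ℕ) : 0 < T.heightSum n :=
  (T.height_pos n (Classical.arbitrary A)).trans_le (T.height_le_heightSum n _)

theorem Q_self (m : ℕ) : T.Q m m = 1 := by
  cases m with
  | zero => rw [Q]
  | succ m => rw [Q, if_neg (by omega)]

theorem Q_succ {m n : ℕ} (h : m ≤ n) : T.Q m (n + 1) = (T.iter n).arrowMatrix * T.Q m n := by
  rw [Q, if_pos h]

theorem arrowMatrix_mulVec (S : IETData A) (v : A → ℤ) :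
    S.arrowMatrix.mulVec v = v + Pi.single S.loser (v S.winner) := by
  rw [arrowMatrix, Matrix.add_mulVec, Matrix.one_mulVec, Matrix.single_mulVec]
  ext α
  by_cases h : α = S.loser
  · subst h; simp
  · simp [h]

theorem Q_mulVec_height {m n : ℕ} (h : m ≤ n) :
    (T.Q m n).mulVec (fun α => (T.height m α : ℤ)) = fun α => (T.height n α : ℤ) := by
  induction n, h using Nat.le_induction with
  | base => rw [Q_self, Matrix.one_mulVec]
  | succ n h ih =>
    rw [Q_succ T h, ← Matrix.mulVec_mulVec, ih, arrowMatrix_mulVec]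
    ext α
    by_cases hα : α = (T.iter n).loser
    · subst hα; rw [height_succ_loser]; simp
    · rw [height_succ_of_ne T hα]; simp [hα]

theorem Q_nonneg (m n : ℕ) (α β : A) : 0 ≤ T.Q m n α β := by
  have h1 : ∀ α β, 0 ≤ (1 : Matrix A A ℤ) α β := fun α β => by
    rw [Matrix.one_apply]; split_ifs <;> simp
  induction n generalizing α β with
  | zero => rw [Q]; exact h1 α β
  | succ n ih =>
    rw [Q]
    split_ifs
    · rw [Matrix.mul_apply]
      refine Finset.sum_nonneg fun γ _ => mul_nonneg ?_ (ih γ β)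
      rw [arrowMatrix, Matrix.add_apply, Matrix.single_apply]
      refine add_nonneg (h1 α γ) ?_
      split_ifs <;> simp
    · exact h1 α β

theorem sum_Q_mul_height {m n : ℕ} (h : m ≤ n) :
    ∑ α, ∑ β, (T.Q m n α β : ℝ) * T.height m β = T.heightSum n := by
  unfold heightSum
  push_cast
  refine Finset.sum_congr rfl fun α _ => ?_
  have := congrFun (T.Q_mulVec_height h) α
  simp only [Matrix.mulVec, dotProduct] at this
  exact_mod_cast this

/-- `Q m n` is nonnegative and carries the heights at `m` to those at `n`. A lower bound for all
heights at `m` therefore turns growth of `heightSum` into a bound for the norm. -/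
theorem entrySum_Q_mul_le {m n : ℕ} (h : m ≤ n) {c : ℝ} (hc : ∀ β, c ≤ T.height m β) :
    entrySum (T.Q m n) * c ≤ T.heightSum n := by
  rw [← sum_Q_mul_height T h, entrySum, Finset.sum_mul]
  refine Finset.sum_le_sum fun α _ => ?_
  rw [Finset.sum_mul]
  refine Finset.sum_le_sum fun β _ => ?_
  have : (0 : ℝ) ≤ T.Q m n α β := by exact_mod_cast T.Q_nonneg m n α β
  rw [abs_of_nonneg this]
  exact mul_le_mul_of_nonneg_left (hc β) this

theorem entrySum_Q_zero (n : ℕ) : entrySum (T.Q 0 n) = T.heightSum n := by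
  rw [← sum_Q_mul_height T (Nat.zero_le n), entrySum]
  refine Finset.sum_congr rfl fun α _ => Finset.sum_congr rfl fun β _ => ?_
  have : (0 : ℝ) ≤ T.Q 0 n α β := by exact_mod_cast T.Q_nonneg 0 n α β
  rw [abs_of_nonneg this, height]
  simp

end Height

section MinDist

theorem minDist_le {L : ℝ} {S : Set ℝ} {x y : ℝ} (hx : x ∈ S ∪ {0, L}) (hy : y ∈ S ∪ {0, L})
    (hxy : x ≠ y) : minDist L S ≤ |x - y| :=
  csInf_le ⟨0, by rintro r ⟨a, -, b, -, -, rfl⟩; exact abs_nonneg _⟩ ⟨x, hx, y, hy, hxy, rfl⟩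

end MinDist

/-! ### Condition (D) bounds the lengths of T(n) from below -/

section Iter

variable {A : Type*} [Fintype A] [DecidableEq A] [Nontrivial A] {T : IETData A}

theorem isInduced_iter (hpos : ∀ α, 0 < T.len α) (hk : T.Keane) (n : ℕ) :
    IsInduced T (T.iter n) (T.height n) := by
  induction n with
  | zero => exact isInduced_self hpos
  | succ n ih => rw [iter_succ]; exact ih.step hk

theorem winner_ne_loser_iter (hpos : ∀ α, 0 < T.len α) (hk : T.Keane) (n : ℕ) :
    (T.iter n).winner ≠ (T.iter n).loser :=
  winner_ne_loser ((isInduced_iter hpos hk n).lastTop_ne_lastBot hk)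

/-- The area of the towers is preserved: a piece of the winner's tower, as wide as the loser's
tower, is stacked with the latter. -/
theorem sum_height_mul_len (hpos : ∀ α, 0 < T.len α) (hk : T.Keane) (n : ℕ) :
    ∑ α, (T.height n α : ℝ) * (T.iter n).len α = T.total := by
  induction n with
  | zero => simp [height, total, iter]
  | succ n ih =>
    have hwl := winner_ne_loser_iter hpos hk n
    have hw : (T.iter n).winner ∈ Finset.univ.erase (T.iter n).loser := by simp [hwl]
    rw [← ih, ← Finset.add_sum_erase _ _ (Finset.mem_univ (T.iter n).loser),
      ← Finset.add_sum_erase _ _ hw,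
      ← Finset.add_sum_erase _ (fun α => (T.height n α : ℝ) * (T.iter n).len α)
        (Finset.mem_univ (T.iter n).loser), ← Finset.add_sum_erase _ _ hw,
      height_succ_loser, height_succ_of_ne T hwl, iter_succ, step_len,
      Function.update_of_ne hwl.symm, Function.update_self]
    have : ∀ α ∈ (Finset.univ.erase (T.iter n).loser).erase (T.iter n).winner,
        (T.height (n + 1) α : ℝ) * Function.update (T.iter n).len (T.iter n).winner
          ((T.iter n).len (T.iter n).winner - (T.iter n).len (T.iter n).loser) α =
        T.height n α * (T.iter n).len α := by
      intro α hα
      rw [height_succ_of_ne T (Finset.ne_of_mem_erase (Finset.mem_of_mem_erase hα)),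
        Function.update_of_ne (Finset.ne_of_mem_erase hα)]
    rw [Finset.sum_congr rfl this]
    push_cast
    ring

theorem height_mul_len_le (hpos : ∀ α, 0 < T.len α) (hk : T.Keane) (n : ℕ) (α : A) :
    (T.height n α : ℝ) * (T.iter n).len α ≤ T.total := by
  rw [← sum_height_mul_len hpos hk n]
  exact Finset.single_le_sum (f := fun α => (T.height n α : ℝ) * (T.iter n).len α)
    (fun β _ => mul_nonneg (Nat.cast_nonneg _) ((isInduced_iter hpos hk n).pos β).le)
    (Finset.mem_univ α)

theorem topLeft_iter_mem (hpos : ∀ α, 0 < T.len α) (hk : T.Keane) {n N : ℕ}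
    (hN : T.heightSum n ≤ N) (α : A) :
    (T.iter n).topLeft α ∈ T.iterSingularities N ∪ {0, T.total} := by
  have hS := isInduced_iter hpos hk n
  rcases Nat.eq_zero_or_pos ((T.iter n).top α : ℕ) with h | h
  · rw [topLeft_of_zero _ h]; simp
  · obtain ⟨i, hi, hi'⟩ := hS.hits α h
    exact .inl ⟨hS.mem_dom (topLeft_mem_subint hS.pos α), i,
      hi.trans_le ((T.height_le_heightSum n α).trans hN), hi'⟩

/-- A letter that is not last on the top separates two left endpoints of T(n). The last one has no
right neighbour, and the right end of the domain of T(n) need not belong to the set; if it loses,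
its length appears between left endpoints one step later, whence `n + 1`. -/
theorem minDist_le_len_iter (hpos : ∀ α, 0 < T.len α) (hk : T.Keane) (n : ℕ) (α : A) :
    minDist T.total (T.iterSingularities (T.heightSum (n + 1))) ≤ (T.iter n).len α := by
  have hS := isInduced_iter hpos hk n
  have hne := hS.lastTop_ne_lastBot hk
  set S := T.iter n with hSdef
  have hmono : T.heightSum n ≤ T.heightSum (n + 1) :=
    T.heightSum_strictMono.monotone (Nat.le_succ n)
  have hnl : ∀ β, β ≠ S.lastTop → ∃ δ, S.topLeft δ = S.topLeft β + S.len β := by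
    intro β hβ
    obtain ⟨δ, hδ⟩ := exists_next S.top (γ := β) fun h => hβ <| S.top.injective <| Fin.ext <| by
      have := S.top_lastTop; omega
    exact ⟨δ, left_next S.top S.len hδ⟩
  have key : ∀ β, β ≠ S.lastTop →
      minDist T.total (T.iterSingularities (T.heightSum (n + 1))) ≤ S.len β := by
    intro β hβ
    obtain ⟨δ, hδ⟩ := hnl β hβ
    have hpβ := hS.pos β
    refine (minDist_le (topLeft_iter_mem hpos hk hmono δ) (topLeft_iter_mem hpos hk hmono β)
      ?_).trans ?_
    · rw [← hSdef, hδ]; linarith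
    · rw [← hSdef, hδ, abs_of_pos] <;> linarith
  by_cases hα : α = S.lastTop
  · subst hα
    by_cases hlt : S.len S.lastBot < S.len S.lastTop
    · exact (key _ hne.symm).trans hlt.le
    -- The losing letter is moved to the right end of the winner's interval: its new left endpoint
    -- is at distance `S.len S.lastTop` from the old left endpoint of the winner's right neighbour
    -- `δ`.
    · obtain ⟨δ, hδ⟩ := hnl S.lastBot hne.symm
      have e := step_topLeft_lastTop_of_not_lt hne hlt
      have hp := hS.pos S.lastTop
      refine (minDist_le (topLeft_iter_mem hpos hk hmono δ)
        (topLeft_iter_mem hpos hk le_rfl S.lastTop) ?_).trans ?_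
      · rw [iter_succ, ← hSdef, hδ, e]; linarith
      · rw [iter_succ, ← hSdef, hδ, e, abs_of_pos] <;> linarith
  · exact key α hα

theorem ConditionD.exists_le_len_iter (hD : T.ConditionD) (hpos : ∀ α, 0 < T.len α)
    (hk : T.Keane) {ε : ℝ} (hε : 0 < ε) : ∃ c : ℝ, 0 < c ∧ c ≤ 1 ∧ ∀ n α,
      c ≤ (T.iter n).len α * (T.heightSum n : ℝ) ^ (1 + ε) := by
  obtain ⟨C, hC, h⟩ := hD ε hε
  -- The factor 2 pays for `heightSum (n + 1) ≤ 2 * heightSum n`.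
  refine ⟨min 1 (C / 2 ^ (1 + ε)), by positivity, min_le_left _ _, fun n α => ?_⟩
  refine (min_le_right _ _).trans ?_
  have h1 := (h (T.heightSum (n + 1)) (T.heightSum_pos _)).trans
    (minDist_le_len_iter hpos hk n α)
  have h2 : (0 : ℝ) < T.heightSum (n + 1) := by exact_mod_cast T.heightSum_pos (n + 1)
  rw [div_le_iff₀ (by positivity)] at h1
  rw [div_le_iff₀ (by positivity), mul_assoc, ← Real.mul_rpow (by positivity) (by positivity)]
  refine h1.trans (mul_le_mul_of_nonneg_left ?_ ((isInduced_iter hpos hk n).pos α).le)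
  refine Real.rpow_le_rpow h2.le ?_ (by positivity)
  rw [mul_comm]
  exact_mod_cast T.heightSum_succ_le n

end Iter
-- How letters move in the two rows
theorem exists_succ_le_of_lt_add {f : ℕ → ℕ} {k : ℕ} (h : f k < f 0 + k) :
    ∃ i < k, f (i + 1) ≤ f i := by
  by_contra! hcon
  have : ∀ i ≤ k, f 0 + i ≤ f i := by
    intro i
    induction i with
    | zero => intro _; omega
    | succ i ih =>
      intro hi
      have h1 := ih (by omega)
      have h2 := hcon i (by omega)
      omega
  have := this k le_rfl
  omega

section RauzyOrder

variable {A : Type*} {d : ℕ} (e : A ≃ Fin d) {w l p : A}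

theorem le_rauzy_of_ne_last (hl : (e l : ℕ) + 1 = d) (hp : p ≠ l) :
    e p ≤ (e.trans (rauzyPerm (e w))) p :=
  le_rauzyPos fun h => hp (e.injective (Fin.ext (by omega)))

theorem lt_of_rauzy_eq (hl : (e l : ℕ) + 1 = d) (hp : p ≠ l) (hpw : p ≠ w)
    (h : (e.trans (rauzyPerm (e w))) p = e p) : e p < e w := by
  by_contra hcon
  have h1 : e w < e p := lt_of_le_of_ne (not_lt.mp hcon) (e.injective.ne hpw.symm)
  have h2 : (e p : ℕ) + 1 ≠ d := fun h => hp (e.injective (Fin.ext (by omega)))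
  have h3 := (e p).isLt
  have h4 := rauzyPos_val_of_lt h1 (by omega)
  change rauzyPos (e w) (e p) = e p at h
  rw [h] at h4
  omega

theorem rauzy_lt_of_lt (hl : (e l : ℕ) + 1 = d) (hwl : w ≠ l) (hp : p ≠ l) (hpw : e p < e w)
    {u : A} (hu : e p < e u) :
    (e.trans (rauzyPerm (e w))) p < (e.trans (rauzyPerm (e w))) u := by
  change rauzyPos (e w) (e p) < rauzyPos (e w) (e u)
  by_cases hul : u = l
  · subst hul
    exact (rauzyPos_lt_last_iff hl (e.injective.ne hwl) (e.injective.ne hp)).2 hpw.le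
  · refine (rauzyPos_lt_iff ?_ ?_).2 hu
    · exact fun h => hp (e.injective (Fin.ext (by omega)))
    · exact fun h => hul (e.injective (Fin.ext (by omega)))

end RauzyOrder

section StepOrder

variable {A : Type*} [Fintype A] [Nonempty A] {S : IETData A} {p : A}

theorem lt_lastTop (hp : p ≠ S.lastTop) : S.top p < S.top S.lastTop := by
  have h1 := S.top_lastTop
  have h2 := (S.top p).isLt
  have h3 : (S.top p : ℕ) ≠ S.top S.lastTop := fun h => hp (S.top.injective (Fin.ext h))
  rw [Fin.lt_def]; omega

theorem lt_lastBot (hp : p ≠ S.lastBot) : S.bot p < S.bot S.lastBot := by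
  have h1 := S.bot_lastBot
  have h2 := (S.bot p).isLt
  have h3 : (S.bot p : ℕ) ≠ S.bot S.lastBot := fun h => hp (S.bot.injective (Fin.ext h))
  rw [Fin.lt_def]; omega

variable [DecidableEq A]

/-- The loser is the only letter ever moved to the left. -/
theorem le_step_pos (hp : p ≠ S.loser) : S.top p ≤ S.step.top p ∧ S.bot p ≤ S.step.bot p := by
  by_cases h : S.len S.lastBot < S.len S.lastTop
  · rw [loser_of_lt h] at hp
    rw [step_top_of_lt h, step_bot_of_lt h]
    exact ⟨le_rfl, le_rauzy_of_ne_last _ S.bot_lastBot hp⟩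
  · rw [loser_of_not_lt h] at hp
    rw [step_top_of_not_lt h, step_bot_of_not_lt h]
    exact ⟨le_rauzy_of_ne_last _ S.top_lastTop hp, le_rfl⟩

/-- In one row the winner is last. In the other the loser is inserted after the winner and pushes
everything beyond it, so a letter that stands still lies before the winner. -/
theorem lt_winner_of_step_pos_eq (hp : p ≠ S.loser) (hpw : p ≠ S.winner)
    (ht : S.step.top p = S.top p) (hb : S.step.bot p = S.bot p) :
    S.top p < S.top S.winner ∧ S.bot p < S.bot S.winner := by
  by_cases h : S.len S.lastBot < S.len S.lastTop
  · rw [loser_of_lt h] at hp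
    rw [winner_of_lt h] at hpw ⊢
    rw [step_bot_of_lt h] at hb
    exact ⟨lt_lastTop hpw, lt_of_rauzy_eq _ S.bot_lastBot hp hpw hb⟩
  · rw [loser_of_not_lt h] at hp
    rw [winner_of_not_lt h] at hpw ⊢
    rw [step_top_of_not_lt h] at ht
    exact ⟨lt_of_rauzy_eq _ S.top_lastTop hp hpw ht, lt_lastBot hpw⟩

theorem step_pos_lt_of_lt (hne : S.lastTop ≠ S.lastBot) (hp : p ≠ S.loser)
    (hpw : S.top p < S.top S.winner ∧ S.bot p < S.bot S.winner) {u : A}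
    (hu : S.top p < S.top u ∧ S.bot p < S.bot u) :
    S.step.top p < S.step.top u ∧ S.step.bot p < S.step.bot u := by
  by_cases h : S.len S.lastBot < S.len S.lastTop
  · rw [loser_of_lt h] at hp
    rw [winner_of_lt h] at hpw
    rw [step_top_of_lt h, step_bot_of_lt h]
    exact ⟨hu.1, rauzy_lt_of_lt _ S.bot_lastBot hne hp hpw.2 hu.2⟩
  · rw [loser_of_not_lt h] at hp
    rw [winner_of_not_lt h] at hpw
    rw [step_top_of_not_lt h, step_bot_of_not_lt h]
    exact ⟨rauzy_lt_of_lt _ S.top_lastTop hne.symm hp hpw.1 hu.1, hu.2⟩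

end StepOrder

/-! ### Spreading of large heights among the winners -/

section Spread

variable {A : Type*} [Fintype A] [DecidableEq A] [Nonempty A] {T : IETData A}

theorem exists_le_height {n : ℕ} {M : ℝ} (h : Fintype.card A * M ≤ T.heightSum n) :
    ∃ α, M ≤ T.height n α := by
  by_contra! hcon
  have : (T.heightSum n : ℝ) < ∑ _α : A, M := by
    unfold heightSum
    push_cast
    exact Finset.sum_lt_sum_of_nonempty Finset.univ_nonempty fun α _ => hcon α
  rw [Finset.sum_const, nsmul_eq_mul, Finset.card_univ] at this
  linarith

theorem le_height_mono {m n : ℕ} (h : m ≤ n) {M : ℝ} {α : A} (hM : M ≤ T.height m α) :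
    M ≤ T.height n α :=
  hM.trans (by exact_mod_cast T.height_mono α h)

/-- If the set of letters of height at least `M` does not change, then no winner in this set comes
after a winner outside of it. -/
theorem le_height_winner_of_le {M : ℝ} {a c m n : ℕ}
    (hT : ∀ α, M ≤ T.height c α → M ≤ T.height a α) (ham : a ≤ m) (hmn : m ≤ n) (hnc : n < c)
    (hn : M ≤ T.height a (T.iter n).winner) : M ≤ T.height a (T.iter m).winner := by
  by_contra hm
  refine absurd hn ?_
  induction n, hmn using Nat.le_induction with
  | base => exact hm
  | succ n hmn ih =>
    intro hn
    have hn' := fun h => ih (by omega) h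
    have hne : (T.iter n).step.winner ≠ (T.iter n).winner := by
      rw [← iter_succ]
      intro h
      rw [h] at hn
      exact hn' hn hn
    have hl := loser_step hne
    rw [← iter_succ] at hl
    have h1 := T.height_succ_loser (n + 1)
    rw [hl] at h1
    have h2 : M ≤ T.height (n + 1 + 1) (T.iter n).winner := by
      refine (le_height_mono (show a ≤ n + 1 by omega) hn).trans ?_
      rw [h1]
      push_cast
      linarith [(T.height (n + 1) (T.iter n).winner).cast_nonneg (α := ℝ)]
    have := hT _ (le_height_mono (show n + 1 + 1 ≤ c by omega) h2)
    exact hn' this this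

/-- Call a letter tall if its height is at least `M`. Tall letters remain tall, so among `d`
consecutive pairs of windows one leaves the tall set unchanged. In the first window of this pair `α`
wins and in the second a tall letter wins; since a tall winner cannot follow a short one, `α` was
already tall. -/
theorem le_height_of_complete {M : ℝ} {X : Finset A} {s : ℕ → ℕ} (hs : Monotone s)
    (hcomp : ∀ j < 2 * Fintype.card A, ∀ w ∈ X, ∃ n, s j ≤ n ∧ n < s (j + 1) ∧
      (T.iter n).winner = w)
    (hsub : ∀ α, M ≤ T.height (s (2 * Fintype.card A)) α → α ∈ X)
    (hne : ∃ α, M ≤ T.height (s 0) α) {α : A} (hα : α ∈ X) :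
    M ≤ T.height (s (2 * Fintype.card A)) α := by
  classical
  let tall : ℕ → Finset A := fun i => Finset.univ.filter fun α => M ≤ T.height (s (2 * i)) α
  obtain ⟨α₀, hα₀⟩ := hne
  have h0 : 0 < (tall 0).card := Finset.card_pos.2 ⟨α₀, by simpa [tall] using hα₀⟩
  have hd : (tall (Fintype.card A)).card ≤ Fintype.card A := Finset.card_le_univ _
  obtain ⟨i, hi, hcard⟩ := exists_succ_le_of_lt_add (f := fun i => (tall i).card)
    (k := Fintype.card A) (by omega)
  have hsubset : tall i ⊆ tall (i + 1) := by
    intro β hβ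
    simp only [tall, Finset.mem_filter, Finset.mem_univ, true_and] at hβ ⊢
    exact le_height_mono (hs (by omega)) hβ
  have heq := Finset.eq_of_subset_of_card_le hsubset hcard
  have hT : ∀ β, M ≤ T.height (s (2 * i + 2)) β → M ≤ T.height (s (2 * i)) β := by
    intro β hβ
    have : β ∈ tall (i + 1) := by simpa [tall, mul_add] using hβ
    rw [← heq] at this
    simpa [tall] using this
  have hα₀i : M ≤ T.height (s (2 * i)) α₀ := le_height_mono (hs (by omega)) hα₀
  have hα₀X : α₀ ∈ X := hsub _ (le_height_mono (hs (by omega)) hα₀i)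
  obtain ⟨m, hm1, hm2, hm3⟩ := hcomp (2 * i) (by omega) α hα
  obtain ⟨n, hn1, hn2, hn3⟩ := hcomp (2 * i + 1) (by omega) α₀ hα₀X
  refine le_height_mono (hs (show 2 * i ≤ _ by omega)) ?_
  rw [← hm3]
  refine le_height_winner_of_le hT hm1 (by omega) hn2 ?_
  rw [hn3]
  exact hα₀i

end Spread

/-! ### The winners cannot remain in a proper subset of the alphabet -/

section Isolated

variable {A : Type*} [Fintype A] [DecidableEq A] [Nontrivial A] {T : IETData A}

/-- `X` would be a final segment of both rows, so its first letters in the two rows would start at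
the same point, the total length of the complement. -/
theorem IsInduced.not_separated {S : IETData A} {h : A → ℕ} (hS : IsInduced T S h)
    (hk : T.Keane) {X : Finset A} (hne : X.Nonempty) (huniv : X ≠ Finset.univ)
    (hX : ∀ p ∉ X, ∀ w ∈ X, S.top p < S.top w ∧ S.bot p < S.bot w) : False := by
  have key : ∀ e : A ≃ Fin (Fintype.card A), (∀ p ∉ X, ∀ w ∈ X, e p < e w) →
      ∃ w ∈ X, left e S.len w = ∑ p ∈ Xᶜ, S.len p := by
    intro e he
    obtain ⟨w, hw, hmin⟩ := Finset.exists_min_image X e hne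
    refine ⟨w, hw, Finset.sum_congr ?_ fun _ _ => rfl⟩
    ext p
    simp only [Finset.mem_filter, Finset.mem_univ, true_and, Finset.mem_compl]
    exact ⟨fun h hp => absurd (hmin p hp) (not_le.mpr h), fun hp => he p hp w hw⟩
  obtain ⟨w, hw, h1⟩ := key S.top fun p hp w hw => (hX p hp w hw).1
  obtain ⟨w', hw', h2⟩ := key S.bot fun p hp w hw => (hX p hp w hw).2
  obtain ⟨p, hp⟩ : ∃ p, p ∉ X := by
    by_contra! h
    exact huniv (Finset.eq_univ_iff_forall.2 h)
  have hpos : 0 < (S.top w : ℕ) := lt_of_le_of_lt (Nat.zero_le _) (Fin.lt_def.1 (hX p hp w hw).1)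
  exact hS.botLeft_ne_topLeft hk (γ := w') hpos (h2.trans h1.symm)

/-- The letters outside `X` never lose, so the sum `Φ` of their positions is nondecreasing, and
being at most `2 * d * d` it is constant on some window. There these letters stand still, hence
precede each winner in both rows, and they keep preceding it. All of `X` wins in the window, so at
its end the rows are separated. -/
theorem not_forall_mem_of_complete (hpos : ∀ α, 0 < T.len α) (hk : T.Keane) {X : Finset A}
    (hne : X.Nonempty) (huniv : X ≠ Finset.univ) {s : ℕ → ℕ} (hs : Monotone s) {k : ℕ}
    (hkd : 2 * Fintype.card A * Fintype.card A < k)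
    (hcomp : ∀ j < k, ∀ w ∈ X, ∃ n, s j ≤ n ∧ n < s (j + 1) ∧ (T.iter n).winner = w)
    (hX : ∀ n, s 0 ≤ n → n < s k → (T.iter n).winner ∈ X ∧ (T.iter n).loser ∈ X) : False := by
  let Φ : ℕ → ℕ := fun n => ∑ p ∈ Xᶜ, (((T.iter n).top p : ℕ) + (T.iter n).bot p)
  have hterm : ∀ n, s 0 ≤ n → n < s k → ∀ p ∈ Xᶜ, ((T.iter n).top p : ℕ) + (T.iter n).bot p ≤
      ((T.iter (n + 1)).top p : ℕ) + (T.iter (n + 1)).bot p := by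
    intro n h1 h2 p hp
    have hpl : p ≠ (T.iter n).loser := by
      rintro rfl
      exact Finset.mem_compl.1 hp (hX n h1 h2).2
    have := le_step_pos hpl
    rw [iter_succ]
    exact add_le_add this.1 this.2
  have hΦ : ∀ a b, s 0 ≤ a → a ≤ b → b ≤ s k → Φ a ≤ Φ b := by
    intro a b ha hab hb
    induction b, hab using Nat.le_induction with
    | base => exact le_rfl
    | succ b hab ih =>
      exact (ih (by omega)).trans (Finset.sum_le_sum (hterm b (by omega) (by omega)))
  have hbound : Φ (s k) ≤ 2 * Fintype.card A * Fintype.card A := by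
    calc Φ (s k) ≤ ∑ p ∈ Xᶜ, 2 * Fintype.card A := by
          refine Finset.sum_le_sum fun p _ => ?_
          have h1 := ((T.iter (s k)).top p).isLt
          have h2 := ((T.iter (s k)).bot p).isLt
          omega
      _ ≤ 2 * Fintype.card A * Fintype.card A := by
          rw [Finset.sum_const, smul_eq_mul, mul_comm]
          exact Nat.mul_le_mul_left _ (Finset.card_le_univ _)
  obtain ⟨j, hj, hle⟩ := exists_succ_le_of_lt_add (f := fun j => Φ (s j)) (k := k)
    (by omega)
  have hs0 : s 0 ≤ s j := hs (Nat.zero_le j)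
  have hsk : s (j + 1) ≤ s k := hs hj
  have hconst : ∀ n, s j ≤ n → n < s (j + 1) → ∀ p ∉ X,
      (T.iter n).step.top p = (T.iter n).top p ∧ (T.iter n).step.bot p = (T.iter n).bot p := by
    intro n h1 h2 p hp
    have hpl : p ≠ (T.iter n).loser := by
      rintro rfl
      exact hp (hX n (by omega) (by omega)).2
    have e1 := hΦ (s j) n hs0 h1 (by omega)
    have e2 := hΦ n (n + 1) (by omega) (by omega) (by omega)
    have e3 := hΦ (n + 1) (s (j + 1)) (by omega) (by omega) (by omega)
    have heq : Φ n = Φ (n + 1) := by have hle : Φ (s (j + 1)) ≤ Φ (s j) := hle; omega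
    have := (Finset.sum_eq_sum_iff_of_le (hterm n (by omega) (by omega))).1 heq p
      (Finset.mem_compl.2 hp)
    rw [iter_succ] at this
    have h3 := le_step_pos hpl
    rw [Fin.le_def, Fin.le_def] at h3
    constructor <;> apply Fin.ext <;> omega
  have hright : ∀ n, s j ≤ n → n < s (j + 1) → ∀ p ∉ X,
      (T.iter n).top p < (T.iter n).top (T.iter n).winner ∧
      (T.iter n).bot p < (T.iter n).bot (T.iter n).winner := by
    intro n h1 h2 p hp
    have hXn := hX n (by omega) (by omega)
    refine lt_winner_of_step_pos_eq ?_ ?_ (hconst n h1 h2 p hp).1 (hconst n h1 h2 p hp).2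
    · rintro rfl; exact hp hXn.2
    · rintro rfl; exact hp hXn.1
  refine (isInduced_iter hpos hk (s (j + 1))).not_separated hk hne huniv fun p hp w hw => ?_
  obtain ⟨m, hm1, hm2, rfl⟩ := hcomp j hj w hw
  have : ∀ n, m ≤ n → n ≤ s (j + 1) →
      (T.iter n).top p < (T.iter n).top (T.iter m).winner ∧
      (T.iter n).bot p < (T.iter n).bot (T.iter m).winner := by
    intro n hmn hn
    induction n, hmn using Nat.le_induction with
    | base => exact hright m hm1 hm2 p hp
    | succ n hmn ih =>
      have hpl : p ≠ (T.iter n).loser := by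
        rintro rfl
        exact hp (hX n (by omega) (by omega)).2
      rw [iter_succ]
      exact step_pos_lt_of_lt ((isInduced_iter hpos hk n).lastTop_ne_lastBot hk) hpl
        (hright n (by omega) (by omega) p hp) (ih (by omega))
  exact this _ hm2.le le_rfl

/-- A number of complete windows that is enough for the combinatorial argument. -/
def windowCount (A : Type*) [Fintype A] : ℕ :=
  2 * Fintype.card A * Fintype.card A + 2 * Fintype.card A + 2

theorem not_forall_winner_mem_of_complete (hpos : ∀ α, 0 < T.len α) (hk : T.Keane) {X : Finset A}
    (hne : X.Nonempty) (huniv : X ≠ Finset.univ) {s : ℕ → ℕ} (hs : Monotone s)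
    (hcomp : ∀ j < windowCount A, ∀ w ∈ X, ∃ n, s j ≤ n ∧ n < s (j + 1) ∧ (T.iter n).winner = w)
    (hX : ∀ n, s 0 ≤ n → n < s (windowCount A) → (T.iter n).winner ∈ X)
    {M : ℝ} (hM : Fintype.card A * M ≤ T.heightSum (s 1))
    (hlow : ∀ p ∉ X, T.height (s (windowCount A)) p < M) : False := by
  set d := Fintype.card A with hd
  -- One window until some letter has height at least `M`, `2 * d` to make all of `X` that high, and
  -- `2 * d * d + 1` in which losers also belong to `X`.
  have hW : windowCount A = 2 * d * d + 1 + (2 * d + 1) := by unfold windowCount; rw [← hd]; ring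
  have htall : ∀ α ∈ X, M ≤ T.height (s (2 * d + 1)) α := by
    intro α hα
    refine le_height_of_complete (s := fun j => s (j + 1)) (fun a b h => hs (by omega))
      (fun j hj => hcomp (j + 1) (by omega)) (fun β hβ => ?_) (exists_le_height hM) hα
    by_contra hcon
    exact absurd (hlow β hcon) (not_lt.mpr (le_height_mono (hs (by omega)) hβ))
  refine not_forall_mem_of_complete hpos hk hne huniv (s := fun j => s (j + (2 * d + 1)))
    (fun a b h => hs (by omega)) (k := 2 * d * d + 1) (Nat.lt_succ_self _) (fun j hj => ?_) ?_
  · have := hcomp (j + (2 * d + 1)) (by omega)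
    rwa [show j + 1 + (2 * d + 1) = j + (2 * d + 1) + 1 by ring]
  · intro n h1 h2
    rw [Nat.zero_add] at h1
    rw [← hW] at h2
    have hw := hX n ((hs (Nat.zero_le _)).trans h1) h2
    refine ⟨hw, ?_⟩
    -- A loser outside `X` would inherit the height of a tall winner, contrary to `hlow`.
    by_contra hl
    refine absurd (hlow _ hl) (not_lt.mpr (le_height_mono (show n + 1 ≤ _ by omega) ?_))
    rw [height_succ_loser]
    have := le_height_mono h1 (htall _ hw)
    push_cast
    linarith [(T.height n (T.iter n).loser).cast_nonneg (α := ℝ)]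

/-- Induction on `X`. If all winners lie in `X`, the hypothesis for `X.erase w` forces `w` to win in
every block of `windowCount A ^ (X.card - 1)` intervals of `t`. These blocks are then complete
windows for `X`, and `windowCount A` of them are impossible. -/
theorem exists_winner_notMem (hpos : ∀ α, 0 < T.len α) (hk : T.Keane) {t : ℕ → ℕ}
    (ht : StrictMono t)
    (hM : ∀ i, ∃ M : ℝ, Fintype.card A * M ≤ T.heightSum (t (i + 1)) ∧
      ∀ p N, t i ≤ N → (∀ n, t i ≤ n → n < N → (T.iter n).winner ≠ p) → T.height N p < M)
    (X : Finset A) (huniv : X ≠ Finset.univ) (i : ℕ) :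
    ∃ n, t i ≤ n ∧ n < t (i + windowCount A ^ X.card) ∧ (T.iter n).winner ∉ X := by
  induction X using Finset.strongInduction generalizing i with
  | H X ih =>
  by_contra! hcon
  rcases X.eq_empty_or_nonempty with rfl | hne
  · have := hcon (t i) le_rfl (ht (by simp))
    simp at this
  obtain ⟨r, hr⟩ : ∃ r, X.card = r + 1 :=
    ⟨X.card - 1, by have := hne.card_pos; omega⟩
  have hWpos : 0 < windowCount A := by unfold windowCount; omega
  have hrpos : 0 < windowCount A ^ r := pow_pos hWpos r
  have hend : i + windowCount A * windowCount A ^ r = i + windowCount A ^ X.card := by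
    rw [hr, pow_succ, mul_comm]
  obtain ⟨M, hM1, hM2⟩ := hM i
  have hs : Monotone fun j => t (i + j * windowCount A ^ r) := fun a b h =>
    ht.monotone (Nat.add_le_add_left (Nat.mul_le_mul_right _ h) _)
  refine not_forall_winner_mem_of_complete hpos hk hne huniv hs ?_ ?_ (M := M) ?_ ?_
  · intro j hj w hw
    have hle : (j + 1) * windowCount A ^ r ≤ windowCount A * windowCount A ^ r :=
      Nat.mul_le_mul_right _ hj
    have hcard : (X.erase w).card = r := by rw [Finset.card_erase_of_mem hw, hr]; omega
    obtain ⟨n, h1, h2, h3⟩ := ih (X.erase w) (Finset.erase_ssubset hw)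
      (fun h => by simpa using Finset.eq_univ_iff_forall.1 h w) (i + j * windowCount A ^ r)
    rw [hcard, add_assoc, ← Nat.succ_mul] at h2
    refine ⟨n, h1, h2, ?_⟩
    have hnX := hcon n ((ht.monotone (Nat.le_add_right _ _)).trans h1)
      (h2.trans_le (ht.monotone (by rw [← hend]; exact Nat.add_le_add_left hle i)))
    by_contra hnw
    exact h3 (Finset.mem_erase.2 ⟨hnw, hnX⟩)
  · intro n h1 h2
    simp only [Nat.zero_mul, Nat.add_zero, hend] at h1 h2
    exact hcon n h1 h2
  · refine hM1.trans ?_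
    simp only [Nat.one_mul]
    exact_mod_cast T.heightSum_strictMono.monotone (ht.monotone (by omega))
  · intro p hp
    refine hM2 p _ (ht.monotone (Nat.le_add_right _ _)) fun n h1 h2 => ?_
    rw [hend] at h2
    rintro rfl
    exact hp (hcon n h1 h2)

end Isolated
-- Iterating an almost linear growth bound
section Growth

theorem exists_one_add_pow_le {ε : ℝ} (hε : 0 < ε) (k : ℕ) :
    ∃ δ : ℝ, 0 < δ ∧ (1 + δ) ^ k ≤ 1 + ε := by
  have h : Filter.Tendsto (fun δ : ℝ => (1 + δ) ^ k) (nhds 0) (nhds ((1 + 0) ^ k)) :=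
    ((continuous_const.add continuous_id).pow k).tendsto 0
  have h1 := (h.mono_left (nhdsWithin_le_nhds (s := Set.Ioi 0))).eventually_le_const
    (show (1 + 0 : ℝ) ^ k < 1 + ε by simpa using hε)
  obtain ⟨δ, h2, h3⟩ := (h1.and (self_mem_nhdsWithin (s := Set.Ioi (0 : ℝ)))).exists
  exact ⟨δ, h3, h2⟩

theorem exists_le_mul_rpow_pow {C δ : ℝ} (hC : 0 < C) (hδ : 0 < δ) (k : ℕ) :
    ∃ K : ℝ, 0 < K ∧ ∀ f : ℕ → ℝ, (∀ j, 0 ≤ f j) → (∀ j, f (j + 1) ≤ C * f j ^ (1 + δ)) →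
      f k ≤ K * f 0 ^ ((1 + δ) ^ k) := by
  induction k with
  | zero => exact ⟨1, one_pos, fun f _ _ => by simp⟩
  | succ k ih =>
    obtain ⟨K, hK, h⟩ := ih
    refine ⟨C * K ^ (1 + δ), by positivity, fun f hf hf' => ?_⟩
    calc f (k + 1) ≤ C * f k ^ (1 + δ) := hf' k
      _ ≤ C * (K * f 0 ^ ((1 + δ) ^ k)) ^ (1 + δ) := by
          have := h f hf hf'
          have h0 := hf k
          gcongr
      _ = C * K ^ (1 + δ) * f 0 ^ ((1 + δ) ^ (k + 1)) := by
          rw [Real.mul_rpow hK.le (Real.rpow_nonneg (hf 0) _), ← Real.rpow_mul (hf 0), pow_succ,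
            mul_assoc]

theorem exists_le_mul_rpow_one_add {C δ ε : ℝ} (hC : 0 < C) (hδ : 0 < δ) {k : ℕ}
    (hk : (1 + δ) ^ k ≤ 1 + ε) :
    ∃ K : ℝ, 0 < K ∧ ∀ f : ℕ → ℝ, (∀ j, 1 ≤ f j) → (∀ j, f (j + 1) ≤ C * f j ^ (1 + δ)) →
      f k ≤ K * f 0 ^ (1 + ε) := by
  obtain ⟨K, hK, h⟩ := exists_le_mul_rpow_pow hC hδ k
  refine ⟨K, hK, fun f hf hf' => (h f (fun j => by linarith [hf j]) hf').trans ?_⟩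
  exact mul_le_mul_of_nonneg_left (Real.rpow_le_rpow_of_exponent_le (hf 0) hk) hK.le

end Growth

/-! ### Condition (D) implies Condition (A) -/

section Diophantine

variable {A : Type*} [Fintype A] [DecidableEq A] [Nontrivial A] {T : IETData A}

theorem one_le_heightSum (T : IETData A) (n : ℕ) : (1 : ℝ) ≤ T.heightSum n := by
  exact_mod_cast T.heightSum_pos n

theorem len_iter_eq_of_not_winner {m n : ℕ} (hmn : m ≤ n) {α : A}
    (h : ∀ j, m ≤ j → j < n → (T.iter j).winner ≠ α) : (T.iter n).len α = (T.iter m).len α := by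
  induction n, hmn using Nat.le_induction with
  | base => rfl
  | succ n hmn ih =>
    rw [iter_succ, step_len, Function.update_of_ne (h n hmn (Nat.lt_succ_self n)).symm]
    exact ih fun j h1 h2 => h j h1 (by omega)

theorem exists_heightSum_between {x : ℝ} {m : ℕ} (h : T.heightSum m < x) :
    ∃ n, m < n ∧ x ≤ T.heightSum n ∧ (T.heightSum n : ℝ) ≤ 2 * x := by
  classical
  have hex : ∃ n, x ≤ T.heightSum n := by
    obtain ⟨n, hn⟩ := exists_nat_ge x
    exact ⟨n, hn.trans (by exact_mod_cast T.heightSum_strictMono.le_apply)⟩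
  have h1 := Nat.find_spec hex
  have hmn : m < Nat.find hex := by
    by_contra hcon
    have : (T.heightSum (Nat.find hex) : ℝ) ≤ T.heightSum m := by
      exact_mod_cast T.heightSum_strictMono.monotone (not_lt.mp hcon)
    linarith
  refine ⟨_, hmn, h1, ?_⟩
  obtain ⟨n, hn⟩ : ∃ n, Nat.find hex = n + 1 := ⟨Nat.find hex - 1, by omega⟩
  have h2 : (T.heightSum n : ℝ) < x := not_le.mp (Nat.find_min hex (show n < _ by omega))
  have h3 : (T.heightSum (n + 1) : ℝ) ≤ 2 * T.heightSum n := by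
    exact_mod_cast T.heightSum_succ_le n
  rw [hn]
  linarith

theorem ConditionD.exists_complete (hD : T.ConditionD) (hpos : ∀ α, 0 < T.len α)
    (htotal : T.total = 1) (hk : T.Keane) {ε : ℝ} (hε : 0 < ε) :
    ∃ C : ℝ, 0 < C ∧ ∀ m, ∃ n, m < n ∧ (T.heightSum n : ℝ) ≤ C * (T.heightSum m : ℝ) ^ (1 + ε) ∧
      ∀ α, ∃ j, m ≤ j ∧ j < n ∧ (T.iter j).winner = α := by
  -- The exponent `1 + δ` will be lost once per interval of `t`, as often as `exists_winner_notMem`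
  -- requires for the complement of one letter.
  obtain ⟨δ, hδ, hδε⟩ := exists_one_add_pow_le hε (windowCount A ^ (Fintype.card A - 1))
  obtain ⟨c, hc, hc1, hlen⟩ := hD.exists_le_len_iter hpos hk hδ
  have hd1 : (1 : ℝ) ≤ Fintype.card A := by exact_mod_cast Fintype.card_pos
  -- A letter without a win since `m` has height at most half of this; the factor 2 gives strict
  -- inequalities. `next m` is a time at which the sum of heights has reached `d * M m` but not
  -- exceeded twice that.
  let M : ℕ → ℝ := fun m => 2 * (T.heightSum m : ℝ) ^ (1 + δ) / c
  have hMlt : ∀ m, (T.heightSum m : ℝ) < Fintype.card A * M m := by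
    intro m
    have h1 := T.one_le_heightSum m
    have h2 : (T.heightSum m : ℝ) ≤ (T.heightSum m : ℝ) ^ (1 + δ) :=
      Real.self_le_rpow_of_one_le h1 (by linarith)
    have h3 : 2 * (T.heightSum m : ℝ) ^ (1 + δ) ≤ M m :=
      le_div_self (by positivity) hc hc1
    nlinarith
  choose next hnext1 hnext2 hnext3 using fun m => exists_heightSum_between (hMlt m)
  obtain ⟨K, hK, hgrow⟩ := exists_le_mul_rpow_one_add
    (C := 2 * (Fintype.card A * (2 / c))) (by positivity) hδ hδε
  refine ⟨K, hK, fun m => ?_⟩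
  let t : ℕ → ℕ := fun i => next^[i] m
  have htsucc : ∀ i, t (i + 1) = next (t i) := fun i => Function.iterate_succ_apply' next i m
  have ht : StrictMono t := strictMono_nat_of_lt_succ fun i => by rw [htsucc]; exact hnext1 _
  have hM : ∀ i, ∃ M : ℝ, Fintype.card A * M ≤ T.heightSum (t (i + 1)) ∧
      ∀ p N, t i ≤ N → (∀ n, t i ≤ n → n < N → (T.iter n).winner ≠ p) → T.height N p < M := by
    intro i
    refine ⟨M (t i), by rw [htsucc]; exact hnext2 _, fun p N hN hp => ?_⟩
    have h1 := height_mul_len_le hpos hk N p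
    rw [len_iter_eq_of_not_winner hN hp, htotal] at h1
    have h2 := hlen (t i) p
    have h3 : (0 : ℝ) < (T.heightSum (t i) : ℝ) ^ (1 + δ) := by
      have := T.one_le_heightSum (t i)
      positivity
    rw [lt_div_iff₀ hc]
    calc (T.height N p : ℝ) * c ≤
          T.height N p * ((T.iter (t i)).len p * (T.heightSum (t i) : ℝ) ^ (1 + δ)) := by gcongr
      _ = (T.height N p * (T.iter (t i)).len p) * (T.heightSum (t i) : ℝ) ^ (1 + δ) := by ring
      _ ≤ 1 * (T.heightSum (t i) : ℝ) ^ (1 + δ) := by gcongr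
      _ < 2 * (T.heightSum (t i) : ℝ) ^ (1 + δ) := by linarith
  refine ⟨t (windowCount A ^ (Fintype.card A - 1)), ?_, ?_, fun α => ?_⟩
  · exact ht (pow_pos (by unfold windowCount; omega) _ : 0 < _)
  · refine hgrow (fun i => (T.heightSum (t i) : ℝ)) (fun i => T.one_le_heightSum _) fun i => ?_
    rw [htsucc]
    refine (hnext3 (t i)).trans_eq ?_
    simp only [M]
    ring
  · obtain ⟨n, h1, h2, h3⟩ := exists_winner_notMem hpos hk ht hM (Finset.univ.erase α)
      (fun h => by simpa using Finset.eq_univ_iff_forall.1 h α) 0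
    rw [Finset.card_erase_of_mem (Finset.mem_univ α), Finset.card_univ, Nat.zero_add] at h2
    exact ⟨n, h1, h2, by simpa using h3⟩

/-- The hypothesis bounds the set whose supremum defines `mmySeq (k + 1)`, so the supremum is a true
maximum and not the default value 0. By maximality one more step makes every letter a winner. -/
theorem mmySeq_succ_spec {k n : ℕ}
    (hn : ∀ α, ∃ j, T.mmySeq k ≤ j ∧ j < n ∧ (T.iter j).winner = α) :
    T.mmySeq k < T.mmySeq (k + 1) ∧ T.mmySeq (k + 1) < n ∧
      ∀ α, ∃ j, T.mmySeq k ≤ j ∧ j < T.mmySeq (k + 1) + 1 ∧ (T.iter j).winner = α := by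
  set E : Set ℕ := {n : ℕ | mmySeq T k < n ∧
    ∃ α : A, ∀ j, mmySeq T k ≤ j → j < n → (T.iter j).winner ≠ α} with hE
  have hlt : ∀ i ∈ E, i < n := by
    rintro i ⟨-, α, hα⟩
    obtain ⟨j, h1, h2, h3⟩ := hn α
    by_contra hcon
    exact hα j h1 (by omega) h3
  have hbdd : BddAbove E := ⟨n, fun i hi => (hlt i hi).le⟩
  have hne : E.Nonempty := by
    obtain ⟨α, hα⟩ := exists_ne (T.iter (T.mmySeq k)).winner
    refine ⟨T.mmySeq k + 1, Nat.lt_succ_self _, α, fun j h1 h2 => ?_⟩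
    rw [show j = T.mmySeq k by omega]
    exact hα.symm
  have hs : T.mmySeq (k + 1) = sSup E := rfl
  have hmem := Nat.sSup_mem hne hbdd
  rw [hs]
  refine ⟨hmem.1, hlt _ hmem, fun α => ?_⟩
  by_contra! hcon
  have : sSup E + 1 ∈ E := ⟨hmem.1.trans (Nat.lt_succ_self _), α, hcon⟩
  exact absurd (le_csSup hbdd this) (by omega)

theorem ConditionD.conditionA (hD : T.ConditionD) (hpos : ∀ α, 0 < T.len α)
    (htotal : T.total = 1) (hk : T.Keane) : T.ConditionA := by
  intro ε hε
  -- `2 * d` complete windows, each made of two accelerated steps: one accelerated step just misses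
  -- completeness.
  set r := 2 * (2 * Fintype.card A) with hr
  obtain ⟨δ, hδ, hδε⟩ := exists_one_add_pow_le hε (r + 1)
  obtain ⟨C, hC, hcomp⟩ := hD.exists_complete hpos htotal hk hδ
  have hspec : ∀ k, T.mmySeq k < T.mmySeq (k + 1) ∧
      (T.heightSum (T.mmySeq (k + 1)) : ℝ) ≤ C * (T.heightSum (T.mmySeq k) : ℝ) ^ (1 + δ) ∧
      ∀ α, ∃ j, T.mmySeq k ≤ j ∧ j < T.mmySeq (k + 1) + 1 ∧ (T.iter j).winner = α := by
    intro k
    obtain ⟨n, -, h2, h3⟩ := hcomp (T.mmySeq k)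
    obtain ⟨h4, h5, h6⟩ := mmySeq_succ_spec h3
    refine ⟨h4, le_trans ?_ h2, h6⟩
    exact_mod_cast T.heightSum_strictMono.monotone h5.le
  have hmono : StrictMono T.mmySeq := strictMono_nat_of_lt_succ fun k => (hspec k).1
  obtain ⟨K, hK, hgrow⟩ := exists_le_mul_rpow_one_add hC hδ hδε
  have hd : (0 : ℝ) < Fintype.card A := by exact_mod_cast Fintype.card_pos
  have hlarge : ∀ k, entrySum (T.mmyMatrix (k + r) (k + r + 1)) ≤
      Fintype.card A * K * (T.heightSum (T.mmySeq (k + r)) : ℝ) ^ ε := by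
    intro k
    set a := (T.heightSum (T.mmySeq k) : ℝ) with ha
    have ha1 : 1 ≤ a := T.one_le_heightSum _
    -- At time `mmySeq k` some letter has at least the average height; by time `mmySeq (k + r)` this
    -- has spread to all letters.
    have hmin : ∀ β, a / Fintype.card A ≤ T.height (T.mmySeq (k + r)) β := by
      intro β
      refine le_height_of_complete (X := Finset.univ) (s := fun j => T.mmySeq (k + 2 * j))
        (fun i j h => hmono.monotone (by omega)) (fun j _ w _ => ?_) (fun α _ => Finset.mem_univ α)
        (exists_le_height ?_) (Finset.mem_univ β)
      · obtain ⟨n, h1, h2, h3⟩ := (hspec (k + 2 * j)).2.2 w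
        have := (hspec (k + 2 * j + 1)).1
        exact ⟨n, h1, by rw [show k + 2 * (j + 1) = k + 2 * j + 1 + 1 by ring]; omega, h3⟩
      · rw [mul_div_cancel₀ _ hd.ne']
        exact le_rfl
    have h1 := T.entrySum_Q_mul_le (hmono.monotone (Nat.le_succ (k + r))) hmin
    have h2 := hgrow (fun j => (T.heightSum (T.mmySeq (k + j)) : ℝ))
      (fun j => T.one_le_heightSum _) fun j => (hspec (k + j)).2.1
    have h3 : entrySum (T.mmyMatrix (k + r) (k + r + 1)) * (a / Fintype.card A) ≤
        K * a ^ (1 + ε) := h1.trans h2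
    have h4 : a ≤ T.heightSum (T.mmySeq (k + r)) := by
      rw [ha]
      exact_mod_cast T.heightSum_strictMono.monotone (hmono.monotone (Nat.le_add_right k r))
    rw [← mul_div_assoc, div_le_iff₀ hd, Real.rpow_add (by linarith), Real.rpow_one] at h3
    have h5 : entrySum (T.mmyMatrix (k + r) (k + r + 1)) ≤ Fintype.card A * K * a ^ ε := by
      refine le_of_mul_le_mul_right (h3.trans_eq ?_) (show 0 < a by linarith)
      ring
    refine h5.trans ?_
    gcongr
  have hnn : ∀ k, 0 ≤ entrySum (T.mmyMatrix k (k + 1)) := fun k =>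
    Finset.sum_nonneg fun α _ => Finset.sum_nonneg fun β _ => abs_nonneg _
  -- The sum takes care of the indices below `r`, to which `hlarge` does not apply.
  refine ⟨Fintype.card A * K + ∑ k ∈ Finset.range r, entrySum (T.mmyMatrix k (k + 1)),
    add_pos_of_pos_of_nonneg (by positivity) (Finset.sum_nonneg fun k _ => hnn k), fun k _ => ?_⟩
  have hbase : entrySum (T.mmyMatrix 0 k) = T.heightSum (T.mmySeq k) := T.entrySum_Q_zero _
  have h1 : 1 ≤ (T.heightSum (T.mmySeq k) : ℝ) ^ ε :=
    Real.one_le_rpow (T.one_le_heightSum _) hε.le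
  rw [hbase, add_mul]
  rcases lt_or_ge k r with h | h
  · have h2 := Finset.single_le_sum (f := fun k => entrySum (T.mmyMatrix k (k + 1)))
      (fun k _ => hnn k) (Finset.mem_range.2 h)
    have h3 : 0 ≤ Fintype.card A * K * (T.heightSum (T.mmySeq k) : ℝ) ^ ε := by positivity
    have h4 := le_mul_of_one_le_right (Finset.sum_nonneg fun k (_ : k ∈ Finset.range r) => hnn k) h1
    linarith
  · obtain ⟨k, rfl⟩ := Nat.exists_eq_add_of_le' h
    have h2 : 0 ≤ ∑ k ∈ Finset.range r, entrySum (T.mmyMatrix k (k + 1)) :=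
      Finset.sum_nonneg fun k _ => hnn k
    have h3 := hlarge k
    have h4 := mul_nonneg h2 (zero_le_one.trans h1)
    linarith

end Diophantine
-- Left limits of iterates, with the right end of the domain as an admissible value
/-- To the left of `b` the map `f` is, on the domain of `T`, the translation that takes
`b` to `b'`. -/
def LeftGerm {A : Type*} [Fintype A] (T : IETData A) (f : ℝ → ℝ) (b b' : ℝ) : Prop :=
  ∃ η > 0, ∀ s, b - η < s → s < b → s ∈ T.dom ∧ f s = b' + (s - b)

section Germ

variable {A : Type*} [Fintype A] {T : IETData A} {f g : ℝ → ℝ} {a a' b b' b'' : ℝ}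

theorem LeftGerm.unique (h : T.LeftGerm f b b') (h' : T.LeftGerm f b b'') : b' = b'' := by
  obtain ⟨η, hη, h⟩ := h
  obtain ⟨η', hη', h'⟩ := h'
  have h1 : 0 < min η η' := lt_min hη hη'
  have h2 := min_le_left η η'
  have h3 := min_le_right η η'
  have e1 := (h (b - min η η' / 2) (by linarith) (by linarith)).2
  have e2 := (h' (b - min η η' / 2) (by linarith) (by linarith)).2
  linarith

theorem LeftGerm.eq_of_injOn (hf : Set.InjOn f T.dom) (h : T.LeftGerm f a b)
    (h' : T.LeftGerm f a' b) : a = a' := by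
  obtain ⟨η, hη, h⟩ := h
  obtain ⟨η', hη', h'⟩ := h'
  have h1 : 0 < min η η' := lt_min hη hη'
  have h2 := min_le_left η η'
  have h3 := min_le_right η η'
  have e1 := h (a - min η η' / 2) (by linarith) (by linarith)
  have e2 := h' (a' - min η η' / 2) (by linarith) (by linarith)
  have := hf e1.1 e2.1 (by rw [e1.2, e2.2]; ring)
  linarith

theorem LeftGerm.comp (hg : T.LeftGerm g b' b'') (hf : T.LeftGerm f b b') :
    T.LeftGerm (g ∘ f) b b'' := by
  obtain ⟨η, hη, h⟩ := hf
  obtain ⟨η', hη', h'⟩ := hg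
  refine ⟨min η η', lt_min hη hη', fun s hs1 hs2 => ?_⟩
  have h2 := min_le_left η η'
  have h3 := min_le_right η η'
  obtain ⟨e1, e2⟩ := h s (by linarith) hs2
  refine ⟨e1, ?_⟩
  rw [Function.comp_apply, (h' (f s) (by linarith) (by linarith)).2, e2]
  ring

theorem LeftGerm.eq_of_continuousWithinAt (h : T.LeftGerm f b b')
    (hc : ContinuousWithinAt f T.dom b) : f b = b' := by
  obtain ⟨η, hη, h⟩ := h
  have h1 : Set.Ioo (b - η) b ⊆ T.dom := fun s hs => (h s hs.1 hs.2).1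
  have h2 : Filter.Tendsto f (nhdsWithin b (Set.Ioo (b - η) b)) (nhds (f b)) := hc.mono h1
  have h3 : Filter.Tendsto (fun s => b' + (s - b)) (nhdsWithin b (Set.Ioo (b - η) b))
      (nhds (b' + (b - b))) :=
    ((continuous_const.add (continuous_id.sub continuous_const)).tendsto b).mono_left
      nhdsWithin_le_nhds
  have h4 : Filter.Tendsto f (nhdsWithin b (Set.Ioo (b - η) b)) (nhds (b' + (b - b))) :=
    h3.congr' (by
      filter_upwards [self_mem_nhdsWithin] with s hs
      exact (h s hs.1 hs.2).2.symm)
  have : (nhdsWithin b (Set.Ioo (b - η) b)).NeBot := by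
    rw [nhdsWithin_Ioo_eq_nhdsLT (by linarith)]
    infer_instance
  rw [tendsto_nhds_unique h2 h4]
  ring

theorem LeftGerm.continuousWithinAt (hpos : ∀ α, 0 < T.len α) (hb : b ∈ T.dom)
    (h : T.LeftGerm T.map b (T.map b)) : ContinuousWithinAt T.map T.dom b := by
  obtain ⟨η, hη, h⟩ := h
  obtain ⟨γ, hγ⟩ := exists_mem_subint hb
  have hc : ContinuousAt (fun s => T.map b + (s - b)) b := by fun_prop
  refine (hc.congr ?_).continuousWithinAt
  filter_upwards [Ioo_mem_nhds (show b - η < b by linarith) hγ.2] with s hs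
  rcases lt_or_ge s b with hsb | hsb
  · exact (h s hs.1 hsb).2.symm
  · rw [map_of_mem_subint hpos hγ, map_of_mem_subint hpos (γ := γ) ⟨hγ.1.trans hsb, hs.2⟩]
    ring

theorem leftGerm_of_mem_Ioc (hpos : ∀ α, 0 < T.len α) {γ : A}
    (hb : b ∈ Set.Ioc (T.topLeft γ) (T.topLeft γ + T.len γ)) :
    T.LeftGerm T.map b (b + (T.botLeft γ - T.topLeft γ)) := by
  refine ⟨b - T.topLeft γ, by linarith [hb.1], fun s h1 h2 => ?_⟩
  have hs : s ∈ T.subint γ := ⟨by linarith, by linarith [hb.2]⟩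
  refine ⟨subint_subset_dom hpos γ hs, ?_⟩
  rw [map_of_mem_subint hpos hs]
  ring

theorem leftGerm_of_notMem_singularities (hpos : ∀ α, 0 < T.len α) (hb : b ∈ T.dom)
    (hb0 : 0 < b) (hb' : b ∉ T.singularities) : T.LeftGerm T.map b (T.map b) := by
  obtain ⟨γ, hγ⟩ := exists_mem_subint hb
  have hne : b ≠ T.topLeft γ := by
    rintro rfl
    rcases Nat.eq_zero_or_pos (T.top γ : ℕ) with h | h
    · rw [topLeft_of_zero T h] at hb0; exact hb0.false
    · exact hb' ⟨γ, h, rfl⟩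
  rw [map_of_mem_subint hpos hγ]
  exact leftGerm_of_mem_Ioc hpos ⟨lt_of_le_of_ne hγ.1 hne.symm, hγ.2.le⟩

theorem exists_mem_Ioc (hpos : ∀ α, 0 < T.len α) (hb0 : 0 < b) (hb : b ≤ T.total) :
    ∃ γ, b ∈ Set.Ioc (T.topLeft γ) (T.topLeft γ + T.len γ) := by
  obtain ⟨α, -⟩ := exists_mem_subint (S := T) (x := 0) ⟨le_rfl, hb0.trans_le hb⟩
  have : Nonempty A := ⟨α⟩
  rcases hb.eq_or_lt with rfl | hlt
  · have h1 := T.topLeft_lastTop_add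
    exact ⟨T.lastTop, by linarith [hpos T.lastTop], h1.ge⟩
  obtain ⟨γ, hγ⟩ := exists_mem_subint (S := T) (x := b) ⟨hb0.le, hlt⟩
  rcases hγ.1.eq_or_lt with heq | hlt'
  · have h0 : (T.top γ : ℕ) ≠ 0 := fun h => by
      rw [topLeft_of_zero T h] at heq
      linarith
    have hlt'' := (T.top γ).isLt
    have h1 := left_next T.top T.len (γ := T.top.symm ⟨T.top γ - 1, by omega⟩) (δ := γ)
      (by simp only [Equiv.apply_symm_apply]; omega)
    refine ⟨T.top.symm ⟨T.top γ - 1, by omega⟩, ?_, ?_⟩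
    · have := hpos (T.top.symm ⟨T.top γ - 1, by omega⟩)
      rw [← heq]
      change left T.top T.len _ < left T.top T.len _
      linarith
    · rw [← heq]
      exact h1.le
  · exact ⟨γ, hlt', hγ.2.le⟩

theorem exists_leftGerm_iterate (hpos : ∀ α, 0 < T.len α) (hb0 : 0 < b) (hb : b ≤ T.total)
    (n : ℕ) : ∃ b', 0 < b' ∧ b' ≤ T.total ∧ T.LeftGerm T.map^[n] b b' := by
  induction n with
  | zero =>
    refine ⟨b, hb0, hb, b, hb0, fun s h1 h2 => ⟨⟨by linarith, by linarith⟩, ?_⟩⟩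
    rw [Function.iterate_zero, id]
    ring
  | succ n ih =>
    obtain ⟨b', h1, h2, h3⟩ := ih
    obtain ⟨γ, hγ⟩ := exists_mem_Ioc hpos h1 h2
    refine ⟨b' + (T.botLeft γ - T.topLeft γ), ?_, ?_, ?_⟩
    rotate_left 2
    · rw [Function.iterate_succ']
      exact (leftGerm_of_mem_Ioc hpos hγ).comp h3
    · have := left_nonneg T.bot hpos γ
      change 0 < b' + (left T.bot T.len γ - _)
      linarith [hγ.1]
    · have h4 : T.botLeft γ + T.len γ ≤ T.total := left_add_len_le_sum T.bot hpos γ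
      linarith [hγ.2]

theorem pos_of_mem_singularities (hpos : ∀ α, 0 < T.len α) (hb : b ∈ T.singularities) : 0 < b := by
  obtain ⟨α, hα, rfl⟩ := hb
  exact left_pos T.top hpos hα

theorem Keane.pos_of_hits [Nonempty A] (hk : T.Keane) (hpos : ∀ α, 0 < T.len α) {x : ℝ}
    (hx : x ∈ T.dom) {i : ℕ} (hi : T.map^[i] x ∈ T.singularities) : 0 < x := by
  rcases hx.1.eq_or_lt with rfl | h
  · rcases Nat.eq_zero_or_pos i with rfl | h
    · exact pos_of_mem_singularities hpos hi
    · exact absurd hi (hk.zero_not_hits h)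
  · exact h

/-- Before time `i` the orbit meets neither a singularity nor 0, by Keane, so `T` is continuous from
the left along it. -/
theorem Keane.leftGerm_iterate [Nonempty A] (hk : T.Keane) (hpos : ∀ α, 0 < T.len α) {x : ℝ}
    (hx : x ∈ T.dom) {i : ℕ} (hi : T.map^[i] x ∈ T.singularities) :
    T.LeftGerm T.map^[i] x (T.map^[i] x) := by
  induction i generalizing x with
  | zero =>
    have h0 := hk.pos_of_hits hpos hx hi
    refine ⟨x, h0, fun s h1 h2 => ⟨⟨by linarith, by linarith [hx.2]⟩, ?_⟩⟩
    simp
  | succ i ih =>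
    have h0 := hk.pos_of_hits hpos hx hi
    have h1 : x ∉ T.singularities := fun h =>
      hk.not_hits_twice (i := 0) (j := i + 1) (Nat.succ_pos i) h hi
    have h2 := ih (map_mem_dom hpos hx) (by rwa [← Function.iterate_succ_apply])
    rw [← Function.iterate_succ_apply] at h2
    rw [Function.iterate_succ]
    exact h2.comp (leftGerm_of_notMem_singularities hpos hx h0 h1)

/-- If `T` is discontinuous at all its singularities, then so is `T^{i + 1}` at the points that
`T^i` takes to a singularity. -/
theorem Keane.not_leftGerm_succ [Nonempty A] (hk : T.Keane) (hpos : ∀ α, 0 < T.len α)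
    (hdisc : ∀ x ∈ T.singularities, ¬ ContinuousWithinAt T.map T.dom x) {x : ℝ}
    (hx : x ∈ T.dom) {i : ℕ} (hi : T.map^[i] x ∈ T.singularities) :
    ¬ T.LeftGerm T.map^[i + 1] x (T.map^[i + 1] x) := by
  intro h
  have hdom := singularities_subset_dom hpos hi
  obtain ⟨b, -, -, hb⟩ := exists_leftGerm_iterate hpos (pos_of_mem_singularities hpos hi)
    hdom.2.le 1
  rw [Function.iterate_one] at hb
  have h1 := hb.comp (hk.leftGerm_iterate hpos hx hi)
  rw [← Function.iterate_succ'] at h1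
  rw [h1.unique h, Function.iterate_succ_apply'] at hb
  exact hdisc _ hi (hb.continuousWithinAt hpos hdom)

theorem Keane.mem_iterDiscontinuities [Nonempty A] (hk : T.Keane) (hpos : ∀ α, 0 < T.len α)
    (hdisc : ∀ x ∈ T.singularities, ¬ ContinuousWithinAt T.map T.dom x) {x : ℝ}
    (hx : x ∈ T.dom) {i : ℕ} (hi : T.map^[i] x ∈ T.singularities) :
    x ∈ T.iterDiscontinuities (i + 1) := by
  refine ⟨hx, fun hc => hk.not_leftGerm_succ hpos hdisc hx hi ?_⟩
  obtain ⟨b, -, -, hb⟩ := exists_leftGerm_iterate hpos (hk.pos_of_hits hpos hx hi) hx.2.le (i + 1)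
  rwa [hb.eq_of_continuousWithinAt hc]

/-- If the translated segment left the interval containing its left end, a point of `(w, s]` would
land on the next left endpoint, a singularity. -/
theorem iterate_eq_add_of_forall_notMem (hpos : ∀ α, 0 < T.len α) {w s : ℝ} (hw : w ∈ T.dom)
    (hs : s ∈ T.dom) (hws : w ≤ s) {m : ℕ}
    (h : ∀ v, w < v → v ≤ s → ∀ l < m, T.map^[l] v ∉ T.singularities) :
    T.map^[m] s = T.map^[m] w + (s - w) := by
  induction m generalizing s with
  | zero => simp
  | succ m ih =>
    have hdom : ∀ v, w ≤ v → v ≤ s → v ∈ T.dom := fun v h1 h2 =>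
      ⟨hw.1.trans h1, h2.trans_lt hs.2⟩
    have ih' : ∀ v, w ≤ v → v ≤ s → T.map^[m] v = T.map^[m] w + (v - w) := fun v h1 h2 =>
      ih (hdom v h1 h2) h1 fun u hu1 hu2 l hl => h u hu1 (hu2.trans h2) l (by omega)
    obtain ⟨γ, hγ⟩ := exists_mem_subint (iterate_mem_dom hpos hw m)
    have hs' := ih' s hws le_rfl
    have hmem : T.map^[m] s ∈ T.subint γ := by
      refine ⟨by linarith [hγ.1], ?_⟩
      by_contra! hcon
      have hlt := (iterate_mem_dom hpos hs m).2
      obtain ⟨δ, hδ⟩ := exists_next T.top (γ := γ) fun hlast => by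
        have h1 : T.topLeft γ + T.len γ = T.total := left_add_len_last T.top T.len hlast
        linarith
      have h1 : T.topLeft δ = T.topLeft γ + T.len γ := left_next T.top T.len hδ
      have h2 := ih' (w + (T.topLeft δ - T.map^[m] w)) (by linarith [hγ.2]) (by linarith)
      refine h (w + (T.topLeft δ - T.map^[m] w)) (by linarith [hγ.2]) (by linarith) m
        (Nat.lt_succ_self m) ⟨δ, by omega, ?_⟩
      rw [h2]
      ring
    rw [Function.iterate_succ_apply', Function.iterate_succ_apply', map_of_mem_subint hpos hmem,
      map_of_mem_subint hpos hγ, hs']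
    ring

end Germ

/-! ### Singularities at which a higher iterate is continuous -/

section Merge

variable {A : Type*} [Fintype A] [Nontrivial A] {T : IETData A}

theorem Admissible.exists_map_eq_zero (hadm : T.Admissible) (hpos : ∀ α, 0 < T.len α) :
    ∃ p ∈ T.singularities, T.map p = 0 := by
  have hcard := Fintype.one_lt_card (α := A)
  let α : A := T.bot.symm ⟨0, by omega⟩
  have hα : (T.bot α : ℕ) = 0 := by simp [α]
  refine ⟨T.topLeft α, ⟨α, ?_, rfl⟩, ?_⟩
  · by_contra hcon
    refine hadm 1 le_rfl hcard ?_
    ext β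
    simp only [Set.mem_ofPred_eq, Nat.lt_one_iff]
    have h1 : (T.top β : ℕ) = 0 ↔ β = α :=
      ⟨fun h => T.top.injective (Fin.ext (by omega)), fun h => by subst h; omega⟩
    have h2 : (T.bot β : ℕ) = 0 ↔ β = α :=
      ⟨fun h => T.bot.injective (Fin.ext (by omega)), fun h => by subst h; omega⟩
    rw [h1, h2]
  · rw [map_topLeft hpos]
    exact left_eq_zero T.bot T.len hα

/-- If the discontinuity of `T^{i + 1}` at a point `x` that `T^i` takes to a singularity is lost
for a higher iterate, then the two one-sided limits of `T^{i + 1}` at `x` are the endpoints of the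
domain. -/
theorem Keane.iterate_eq_zero_of_continuousWithinAt (hk : T.Keane) (hpos : ∀ α, 0 < T.len α)
    (hadm : T.Admissible) (hdisc : ∀ x ∈ T.singularities, ¬ ContinuousWithinAt T.map T.dom x)
    {x : ℝ} (hx : x ∈ T.dom) {i n : ℕ} (hi : T.map^[i] x ∈ T.singularities) (hin : i < n)
    (hc : ContinuousWithinAt T.map^[n] T.dom x) :
    T.map^[i + 1] x = 0 ∧ T.LeftGerm T.map^[i + 1] x T.total := by
  have hinj := map_injOn hpos
  have hx0 := hk.pos_of_hits hpos hx hi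
  choose b hb0 hbt hb using exists_leftGerm_iterate hpos hx0 hx.2.le
  have hbsucc : ∀ m, T.LeftGerm T.map (b m) (b (m + 1)) := by
    intro m
    obtain ⟨b', -, -, hb'⟩ := exists_leftGerm_iterate hpos (hb0 m) (hbt m) 1
    rw [Function.iterate_one] at hb'
    have := hb'.comp (hb m)
    rw [← Function.iterate_succ'] at this
    rwa [← this.unique (hb (m + 1))]
  have hbi : b i = T.map^[i] x := (hb i).unique (hk.leftGerm_iterate hpos hx hi)
  have hne : b (i + 1) ≠ T.map^[i + 1] x := by
    intro h
    refine hk.not_leftGerm_succ hpos hdisc hx hi ?_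
    rw [← h]
    exact hb (i + 1)
  have hbn : b n = T.map^[n] x := ((hb n).eq_of_continuousWithinAt hc).symm
  -- The left limits `b` split from the orbit of `x` at time `i + 1` and agree with it at time `n`;
  -- `m` is a time just before they merge.
  obtain ⟨m, hm, hm1, hm2⟩ : ∃ m, i + 1 ≤ m ∧ b m ≠ T.map^[m] x ∧
      b (m + 1) = T.map^[m + 1] x := by
    by_contra! hcon
    have : ∀ m, i + 1 ≤ m → b m ≠ T.map^[m] x := by
      intro m hm
      induction m, hm using Nat.le_induction with
      | base => exact hne
      | succ m hm ih => exact hcon m hm ih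
    exact this n hin hbn
  have hmdom := iterate_mem_dom hpos hx m
  have hgerm := hbsucc m
  rw [hm2, Function.iterate_succ_apply'] at hgerm
  -- Elsewhere `T` is continuous from the left at `T^m x`, and injectivity would make the two orbits
  -- agree already at time `m`.
  have hm0 : T.map^[m] x = 0 := by
    by_contra h0
    refine hm1 (hgerm.eq_of_injOn hinj (leftGerm_of_notMem_singularities hpos hmdom
      (lt_of_le_of_ne hmdom.1 (Ne.symm h0)) fun h => ?_))
    exact hk.not_hits_twice hm hi h
  obtain ⟨p, hp, hp0⟩ := hadm.exists_map_eq_zero hpos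
  obtain ⟨m, rfl⟩ : ∃ k, m = k + 1 := ⟨m - 1, by omega⟩
  have hpm : T.map^[m] x = p := hinj (iterate_mem_dom hpos hx m) (singularities_subset_dom hpos hp)
    (by rw [← Function.iterate_succ_apply' T.map m x, hm0, hp0])
  rw [← hpm] at hp
  obtain rfl : i = m := hk.eq_of_hits hi hp
  refine ⟨hm0, ?_⟩
  -- Otherwise `b (i + 1)` is the image of a left endpoint, so not a singularity by Keane. Then `T`
  -- is continuous from the left there, and injectivity would force `b (i + 1) = 0`.
  have htotal : b (i + 1) = T.total := by
    by_contra hcon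
    have hlt : b (i + 1) < T.total := lt_of_le_of_ne (hbt _) hcon
    have hdom : b (i + 1) ∈ T.dom := ⟨(hb0 _).le, hlt⟩
    obtain ⟨δ, hδ⟩ := exists_mem_Ioc hpos (hb0 i) (hbt i)
    have hbδ := (hbsucc i).unique (leftGerm_of_mem_Ioc hpos hδ)
    have hend : b i = T.topLeft δ + T.len δ := by
      refine hδ.2.eq_of_not_lt fun h => ?_
      obtain ⟨α, -, hα⟩ := hi
      rw [hbi, hα] at hδ h
      have := eq_of_mem_subint hpos (topLeft_mem_subint hpos α) (γ := δ) ⟨hδ.1.le, h⟩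
      subst this
      exact hδ.1.false
    obtain ⟨δ', hδ'⟩ := exists_next T.bot (γ := δ) fun hlast => by
      have h1 : T.botLeft δ + T.len δ = T.total := left_add_len_last T.bot T.len hlast
      linarith
    have h1 : T.botLeft δ' = T.botLeft δ + T.len δ := left_next T.bot T.len hδ'
    have h2 : T.map (T.topLeft δ') = b (i + 1) := by rw [map_topLeft hpos, h1]; linarith
    have h3 : b (i + 1) ∉ T.singularities := by
      rintro ⟨β, hβ, h⟩
      exact hk ⟨δ', β, 1, le_rfl, hβ, by rw [Function.iterate_one, h2, h]⟩
    have h4 := hgerm.unique (leftGerm_of_notMem_singularities hpos hdom (hb0 _) h3)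
    have h5 := hinj (iterate_mem_dom hpos hx (i + 1)) hdom h4
    exact (hb0 (i + 1)).ne' (by rw [← h5, hm0])
  rw [← htotal]
  exact hb (i + 1)

theorem Keane.exists_iterDiscontinuities_of_hits (hk : T.Keane) (hpos : ∀ α, 0 < T.len α)
    (hadm : T.Admissible) (hdisc : ∀ x ∈ T.singularities, ¬ ContinuousWithinAt T.map T.dom x)
    {N : ℕ} (ih : ∀ m < N, ∀ x ∈ T.iterSingularities m, ∀ y ∈ T.iterSingularities m, x ≠ y →
      ∃ n, 1 ≤ n ∧ n ≤ m ∧ ∃ x' ∈ T.iterDiscontinuities n ∪ {0, T.total},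
        ∃ y' ∈ T.iterDiscontinuities n ∪ {0, T.total}, x' ≠ y' ∧ |x' - y'| ≤ |x - y|)
    {x y : ℝ} (hx : x ∈ T.dom) (hy : y ∈ T.dom) (hxy : x ≠ y) {i j : ℕ} (hij : i ≤ j) (hjN : j < N)
    (hi : T.map^[i] x ∈ T.singularities) (hj : T.map^[j] y ∈ T.singularities) :
    ∃ n, 1 ≤ n ∧ n ≤ N ∧ ∃ x' ∈ T.iterDiscontinuities n ∪ {0, T.total},
      ∃ y' ∈ T.iterDiscontinuities n ∪ {0, T.total}, x' ≠ y' ∧ |x' - y'| ≤ |x - y| := by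
  have hyj := hk.mem_iterDiscontinuities hpos hdisc hy hj
  by_cases hxj : x ∈ T.iterDiscontinuities (j + 1)
  · exact ⟨j + 1, by omega, by omega, x, .inl hxj, y, .inl hyj, hxy, le_rfl⟩
  have hlt : i < j := by
    refine lt_of_le_of_ne hij ?_
    rintro rfl
    exact hxj (hk.mem_iterDiscontinuities hpos hdisc hx hi)
  have hc : ContinuousWithinAt T.map^[j + 1] T.dom x := by
    by_contra h
    exact hxj ⟨hx, h⟩
  obtain ⟨h0, η, hη, hleft⟩ := hk.iterate_eq_zero_of_continuousWithinAt hpos hadm hdisc hx hi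
    (show i < j + 1 by omega) hc
  have hxi : x ∈ T.iterSingularities (i + 1) := ⟨hx, i, Nat.lt_succ_self i, hi⟩
  have hyi : ∀ l < i + 1, T.map^[l] y ∉ T.singularities := fun l hl h =>
    hk.not_hits_twice (show l < j by omega) h hj
  have hz : T.map^[i + 1] y ∈ T.iterDiscontinuities (j - i) := by
    rw [show j - i = j - i - 1 + 1 by omega]
    refine hk.mem_iterDiscontinuities hpos hdisc (iterate_mem_dom hpos hy _) ?_
    rw [← Function.iterate_add_apply, show j - i - 1 + (i + 1) = j by omega]
    exact hj
  -- A closer singular point of order `i + 1 < N + 1` gives a smaller pair to which the induction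
  -- applies. Without one, `T^{i + 1}` is a translation between `x` and `y`, on the side of `y`.
  by_cases hv : ∃ v ∈ T.iterSingularities (i + 1), v ≠ x ∧ |x - v| < |x - y|
  · obtain ⟨v, hv1, hv2, hv3⟩ := hv
    obtain ⟨n, hn1, hn2, x', hx', y', hy', h1, h2⟩ :=
      ih (i + 1) (by omega) x hxi v hv1 hv2.symm
    exact ⟨n, hn1, by omega, x', hx', y', hy', h1, h2.trans hv3.le⟩
  push Not at hv
  refine ⟨j - i, by omega, by omega, T.map^[i + 1] y, .inl hz, ?_⟩
  rcases lt_or_gt_of_ne hxy with hlt' | hlt'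
  · have htr := iterate_eq_add_of_forall_notMem hpos hx hy hlt'.le (m := i + 1)
        fun v h1 h2 l hl h => by
      rcases h2.eq_or_lt with rfl | h2
      · exact hyi l hl h
      · have := hv v ⟨⟨hx.1.trans h1.le, h2.trans hy.2⟩, l, hl, h⟩ h1.ne'
        rw [abs_of_neg (by linarith), abs_of_neg (by linarith)] at this
        linarith
    rw [h0] at htr
    refine ⟨0, .inr (by simp), by linarith, ?_⟩
    rw [htr, abs_sub_comm x y]
    simp
  -- On the left of `x` the value at `x` itself is of no use; a point `s` close to `x` carries the
  -- limit `T.total` over to `y`.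
  · obtain ⟨s, hs1, hs2⟩ := exists_between (show max (x - η) y < x from max_lt (by linarith) hlt')
    obtain ⟨hs3, hs4⟩ := hleft s (lt_of_le_of_lt (le_max_left _ _) hs1) hs2
    have hys : y < s := lt_of_le_of_lt (le_max_right _ _) hs1
    have htr := iterate_eq_add_of_forall_notMem hpos hy hs3 hys.le (m := i + 1)
        fun v h1 h2 l hl h => by
      have := hv v ⟨⟨hy.1.trans h1.le, (h2.trans_lt hs2).trans hx.2⟩, l, hl, h⟩ (by linarith)
      rw [abs_of_pos (by linarith), abs_of_pos (by linarith)] at this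
      linarith
    have : T.map^[i + 1] y = T.total - (x - y) := by linarith
    refine ⟨T.total, .inr (by simp), by linarith, ?_⟩
    rw [this, abs_of_pos (show 0 < x - y by linarith), abs_of_neg (by linarith)]
    linarith

theorem Keane.exists_iterDiscontinuities_of_iterSingularities (hk : T.Keane)
    (hpos : ∀ α, 0 < T.len α) (hadm : T.Admissible)
    (hdisc : ∀ x ∈ T.singularities, ¬ ContinuousWithinAt T.map T.dom x) (N : ℕ) :
    ∀ x ∈ T.iterSingularities N, ∀ y ∈ T.iterSingularities N, x ≠ y →
      ∃ n, 1 ≤ n ∧ n ≤ N ∧ ∃ x' ∈ T.iterDiscontinuities n ∪ {0, T.total},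
        ∃ y' ∈ T.iterDiscontinuities n ∪ {0, T.total}, x' ≠ y' ∧ |x' - y'| ≤ |x - y| := by
  induction N using Nat.strong_induction_on with
  | _ N ih =>
  rintro x ⟨hx, i, hiN, hi⟩ y ⟨hy, j, hjN, hj⟩ hxy
  rcases le_total i j with h | h
  · exact hk.exists_iterDiscontinuities_of_hits hpos hadm hdisc ih hx hy hxy h hjN hi hj
  · rw [abs_sub_comm x y]
    exact hk.exists_iterDiscontinuities_of_hits hpos hadm hdisc ih hy hx hxy.symm h hiN hj hi

theorem Keane.exists_iterDiscontinuities (hk : T.Keane)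
    (hpos : ∀ α, 0 < T.len α) (hadm : T.Admissible)
    (hdisc : ∀ x ∈ T.singularities, ¬ ContinuousWithinAt T.map T.dom x) {N : ℕ} (hN : 1 ≤ N)
    {x y : ℝ} (hx : x ∈ T.iterSingularities N ∪ {0, T.total})
    (hy : y ∈ T.iterSingularities N ∪ {0, T.total}) (hxy : x ≠ y) :
    ∃ n, 1 ≤ n ∧ n ≤ N ∧ ∃ x' ∈ T.iterDiscontinuities n ∪ {0, T.total},
      ∃ y' ∈ T.iterDiscontinuities n ∪ {0, T.total}, x' ≠ y' ∧ |x' - y'| ≤ |x - y| := by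
  have key : ∀ z ∈ T.iterSingularities N, ∃ n, 1 ≤ n ∧ n ≤ N ∧ z ∈ T.iterDiscontinuities n := by
    rintro z ⟨hz, i, hi, hi'⟩
    exact ⟨i + 1, by omega, hi, hk.mem_iterDiscontinuities hpos hdisc hz hi'⟩
  rcases hx with hx | hx <;> rcases hy with hy | hy
  · exact hk.exists_iterDiscontinuities_of_iterSingularities hpos hadm hdisc N x hx y hy hxy
  · obtain ⟨n, h1, h2, h3⟩ := key x hx
    exact ⟨n, h1, h2, x, .inl h3, y, .inr hy, hxy, le_rfl⟩
  · obtain ⟨n, h1, h2, h3⟩ := key y hy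
    exact ⟨n, h1, h2, x, .inr hx, y, .inl h3, hxy, le_rfl⟩
  · exact ⟨1, le_rfl, hN, x, .inr hx, y, .inr hy, hxy, le_rfl⟩

theorem ConditionDTop.conditionD (hD : T.ConditionDTop) (hk : T.Keane)
    (hpos : ∀ α, 0 < T.len α) (hadm : T.Admissible)
    (hdisc : ∀ x ∈ T.singularities, ¬ ContinuousWithinAt T.map T.dom x) : T.ConditionD := by
  intro ε hε
  obtain ⟨C, hC, h⟩ := hD ε hε
  have htotal : 0 < T.total := Finset.sum_pos (fun α _ => hpos α) Finset.univ_nonempty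
  refine ⟨C, hC, fun N hN => le_csInf
    ⟨_, 0, .inr (by simp), T.total, .inr (by simp), htotal.ne, rfl⟩ ?_⟩
  rintro r ⟨x, hx, y, hy, hxy, rfl⟩
  obtain ⟨n, hn1, hnN, x', hx', y', hy', hne, hle⟩ :=
    hk.exists_iterDiscontinuities hpos hadm hdisc hN hx hy hxy
  -- The replacing pair may belong to a smaller order `n ≤ N`, for which the bound in (D) is only
  -- stronger.
  refine le_trans ?_ ((h n hn1).trans ((minDist_le hx' hy' hne).trans hle))
  have : (0 : ℝ) < n := by exact_mod_cast hn1
  gcongr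

end Merge
end IETData

theorem mainTheorem2 {A : Type*} [Fintype A] [DecidableEq A] [Nontrivial A] (T : IETData A)
    (hpos : ∀ α, 0 < T.len α) (htotal : T.total = 1) (hadm : T.Admissible) (hkeane : T.Keane)
    (hA : ¬ T.ConditionA) :
    ¬ T.ConditionD ∧
      ((∀ α : A, 0 < (T.top α : ℕ) → ¬ ContinuousWithinAt T.map T.dom (T.topLeft α)) →
        ¬ T.ConditionDTop) := by
  refine ⟨fun hD => hA (hD.conditionA hpos htotal hkeane), fun hdisc hD => hA ?_⟩
  refine IETData.ConditionD.conditionA (hD.conditionD hkeane hpos hadm ?_) hpos htotal hkeane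
  rintro x ⟨α, hα, rfl⟩
  exact hdisc α hα
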